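/- Let $(M,g)$ be a smooth $n$-dimensional Riemannian manifold with Levi-Civita connection $\nabla$ and curvature tensor $R(X,Y)=[\nabla_X,\nabla_Y]-\nabla_{[X,Y]}$, let $f\in C^\infty(M)$ with $f>0$, and let $\pi:T^*M\to M$ be the cotangent bundle. In a local chart $(U,x^i)$ of $M$, let $(x^i,p_i)$ be the induced coordinates on $\pi^{-1}(U)\subset T^*M$, and write $\nabla_{\partial_i}\partial_j=\Gamma^l_{ij}\partial_l$, $R(\partial_i,\partial_j)\partial_l=R_{ijl}{}^{s}\partial_s$, $g_{ij}=g(\partial_i,\partial_j)$, $(g^{ij})=(g_{ij})^{-1}$, $p^i=g^{it}p_t$, $f_i=\partial_i f$, and $R^{k}{}_{j}{}^{i\,s}=g^{kt}g^{im}R_{tjm}{}^{s}$ (summation over repeated indices). The adapted frame on $\pi^{-1}(U)$ consists of the horizontal lifts $E_j={}^H\partial_j=\frac{\partial}{\partial x^j}+p_a\Gamma^a_{hj}\frac{\partial}{\partial p_h}$ and the vertical lifts $E_{\bar j}={}^V dx^j=\frac{\partial}{\partial p_j}$, $j=1,\dots,n$. Put $\alpha=1+g^{-1}(p,p)=1+g^{ij}p_ip_j$,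 and let ${}^{CG}g_f$ be the rescaled Riemannian metric of Cheeger-Gromoll type on $T^*M$, defined at $p\in T^*M$ by $${}^{CG}g_f({}^HX,{}^HY)=f\,g(X,Y),\qquad {}^{CG}g_f({}^V\omega,{}^HY)=0,\qquad {}^{CG}g_f({}^V\omega,{}^V\theta)=\tfrac1\alpha\bigl(g^{-1}(\omega,\theta)+g^{-1}(\omega,p)\,g^{-1}(\theta,p)\bigr)$$ for vector fields $X,Y$ and $1$-forms $\omega,\theta$ on $M$. Let ${}^fA$ be the $(1,2)$-tensor field on $M$ given by ${}^fA(X,Y)=\frac1{2f}\bigl(df(Y)X+df(X)Y-g(X,Y)\,\mathrm{grad} f\bigr)$, that is, with components $${}^fA^l_{ij}=\frac1{2f}\bigl(f_j\delta^l_i+f_i\delta^l_j-g^{lm}f_m\,g_{ij}\bigr).$$ Then the Levi-Civita connection $\widetilde\nabla$ of ${}^{CG}g_f$ satisfies, on $\pi^{-1}(U)$ and for all $i,j\in\{1,\dots,n\}$, $$\begin{aligned} i)\quad&\widetilde\nabla_{E_i}E_j=\bigl(\Gamma^l_{ij}+{}^fA^l_{ij}\bigr)E_l+\tfrac12\,p_sR_{ijl}{}^{s}\,E_{\bar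 l},\\ ii)\quad&\widetilde\nabla_{E_i}E_{\bar j}=\frac1{2f\alpha}\,p_sR^{l}{}_{i}{}^{j\,s}\,E_l-\Gamma^j_{il}\,E_{\bar l},\\ iii)\quad&\widetilde\nabla_{E_{\bar i}}E_j=\frac1{2f\alpha}\,p_sR^{l}{}_{j}{}^{i\,s}\,E_l,\\ iv)\quad&\widetilde\nabla_{E_{\bar i}}E_{\bar j}=\Bigl(-\frac1\alpha\bigl(p^i\delta^j_l+p^j\delta^i_l\bigr)+\frac{\alpha+1}{\alpha^2}\,g^{ij}p_l+\frac1{\alpha^2}\,p^ip^jp_l\Bigr)E_{\bar l}. \end{aligned}$$ -/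

import Mathlib

open Bundle Manifold
open scoped ContDiff

noncomputable section

/-- An affine connection `D` is the Levi-Civita connection of the metric `G` if it is torsion-free
and `v (G(Y, Z)) = G(D_v Y, Z) + G(Y, D_v Z)` for every tangent vector `v` and all vector fields
`Y`, `Z` that are differentiable at its base point. Mathlib's argument order is
`D Y x v = (D_v Y)(x)`. -/
structure IsLeviCivita {V : Type*} [NormedAddCommGroup V] [NormedSpace ℝ V]
    [FiniteDimensional ℝ V] [CompleteSpace V] {H : Type*} [TopologicalSpace H]
    {I : ModelWithCorners ℝ V H} {N : Type*} [TopologicalSpace N] [ChartedSpace H N]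
    [IsManifold I 2 N] (G : ∀ x : N, TangentSpace I x → TangentSpace I x → ℝ)
    (D : CovariantDerivative I V (TangentSpace I : N → Type _)) : Prop where
  torsion_eq_zero : D.torsion = 0
  metric_compatible : ∀ (x : N) (v : TangentSpace I x) (Y Z : ∀ y : N, TangentSpace I y),
    MDifferentiableAt I I.tangent (fun y ↦ (⟨y, Y y⟩ : TangentBundle I N)) x →
    MDifferentiableAt I I.tangent (fun y ↦ (⟨y, Z y⟩ : TangentBundle I N)) x →
    mvfderiv I (fun y ↦ G y (Y y) (Z y)) x v = G x (D Y x v) (Z x) + G x (Y x) (D Z x v)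

namespace CheegerGromoll

/-- The model space `ℝⁿ`. -/
abbrev Eucl (n : ℕ) := EuclideanSpace ℝ (Fin n)

/-- The cotangent space `T*_x M`. -/
abbrev Cotangent (n : ℕ) {M : Type*} [TopologicalSpace M] [ChartedSpace (Eucl n) M] (x : M) :=
  TangentSpace (𝓡 n) x →L[ℝ] ℝ

/-- The cotangent bundle `T*M`. A point `P` is a pair of `P.proj : M` and a covector `P.snd` at
`P.proj`. -/
abbrev CotangentBundle (n : ℕ) (M : Type*) [TopologicalSpace M] [ChartedSpace (Eucl n) M] :=
  TotalSpace (Eucl n →L[ℝ] ℝ) (fun x : M ↦ Cotangent n x)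

/-- The model with corners of the `2n`-dimensional manifold `T*M`. -/
abbrev cotModel (n : ℕ) := (𝓡 n).prod 𝓘(ℝ, Eucl n →L[ℝ] ℝ)

/-- Smooth Riemannian metrics on `M`. -/
abbrev Metric (n : ℕ) (M : Type*) [TopologicalSpace M] [ChartedSpace (Eucl n) M]
    [IsManifold (𝓡 n) ∞ M] :=
  ContMDiffRiemannianMetric (𝓡 n) ∞ (Eucl n) (TangentSpace (𝓡 n) : M → Type _)

/-- Affine connections on `M`. -/
abbrev Connection (n : ℕ) (M : Type*) [TopologicalSpace M] [ChartedSpace (Eucl n) M]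
    [IsManifold (𝓡 n) ∞ M] :=
  CovariantDerivative (𝓡 n) (Eucl n) (TangentSpace (𝓡 n) : M → Type _)

/-- Affine connections on `T*M`. -/
abbrev CotConnection (n : ℕ) (M : Type*) [TopologicalSpace M] [ChartedSpace (Eucl n) M]
    [IsManifold (𝓡 n) ∞ M] :=
  CovariantDerivative (cotModel n) (Eucl n × (Eucl n →L[ℝ] ℝ))
    (TangentSpace (cotModel n) : CotangentBundle n M → Type _)

section Base

variable {n : ℕ} {M : Type*} [TopologicalSpace M] [ChartedSpace (Eucl n) M]
  [IsManifold (𝓡 n) ∞ M]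

/-- The coordinate vector field `∂_i = ∂/∂x^i` of a chart `e`: `de(∂_i)` is the `i`-th standard
basis vector. -/
def coordVec (e : OpenPartialHomeomorph M (Eucl n)) (i : Fin n) (x : M) :
    TangentSpace (𝓡 n) x :=
  VectorField.mpullback (𝓡 n) (𝓡 n) e (fun _ ↦ EuclideanSpace.single i (1 : ℝ)) x

/-- The coordinate one-form `dx^i` of a chart `e`. -/
def coordForm (e : OpenPartialHomeomorph M (Eucl n)) (i : Fin n) (x : M) : Cotangent n x :=
  mvfderiv (𝓡 n) (fun y ↦ e y i) x

/-- `g_{ij}`. -/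
def gLow (g : Metric n M) (e : OpenPartialHomeomorph M (Eucl n)) (x : M) :
    Matrix (Fin n) (Fin n) ℝ :=
  Matrix.of fun i j ↦ g.inner x (coordVec e i x) (coordVec e j x)

/-- `g^{ij}`, the inverse matrix of `g_{ij}`. -/
def gUp (g : Metric n M) (e : OpenPartialHomeomorph M (Eucl n)) (x : M) :
    Matrix (Fin n) (Fin n) ℝ :=
  (gLow g e x)⁻¹

/-- The vector `θ^♯` with `g(θ^♯, v) = θ(v)` for all `v`. -/
def sharp (g : Metric n M) (x : M) (θ : Cotangent n x) : TangentSpace (𝓡 n) x :=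
  ContinuousLinearMap.inverse (g.inner x) θ

/-- The scalar product `g⁻¹(w, θ) = g^{ij} w_i θ_j` of covectors. -/
def gInv (g : Metric n M) (x : M) (w θ : Cotangent n x) : ℝ := w (sharp g x θ)

/-- The Christoffel symbol `Γ^l_{ij} = dx^l(∇_{∂_i} ∂_j)`. -/
def Gam (D : Connection n M) (e : OpenPartialHomeomorph M (Eucl n)) (x : M) (l i j : Fin n) : ℝ :=
  coordForm e l x (D (coordVec e j) x (coordVec e i x))

/-- The curvature `R(X, Y)Z = ∇_X ∇_Y Z - ∇_Y ∇_X Z - ∇_{[X, Y]} Z` on vector fields. -/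
def curvature (D : Connection n M) (X Y Z : ∀ x : M, TangentSpace (𝓡 n) x) (x : M) :
    TangentSpace (𝓡 n) x :=
  D (fun y ↦ D Z y (Y y)) x (X x) - D (fun y ↦ D Z y (X y)) x (Y x)
    - D Z x (VectorField.mlieBracket (𝓡 n) X Y x)

/-- `R_{ijl}^s = dx^s(R(∂_i, ∂_j) ∂_l)`. -/
def Rm (D : Connection n M) (e : OpenPartialHomeomorph M (Eucl n)) (x : M) (i j l s : Fin n) : ℝ :=
  coordForm e s x (curvature D (coordVec e i) (coordVec e j) (coordVec e l) x)

/-- `R^{k}{}_{j}{}^{i s} = g^{kt} g^{im} R_{tjm}^s`. -/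
def RmUp (g : Metric n M) (D : Connection n M) (e : OpenPartialHomeomorph M (Eucl n)) (x : M)
    (k j i s : Fin n) : ℝ :=
  ∑ t, ∑ m, gUp g e x k t * gUp g e x i m * Rm D e x t j m s

/-- The tensor `A(X, Y) = (1 / 2f) (df(Y) X + df(X) Y - g(X, Y) grad f)` of type `(1, 2)`. -/
def tensorA (g : Metric n M) (f : M → ℝ) (x : M) (X Y : TangentSpace (𝓡 n) x) :
    TangentSpace (𝓡 n) x :=
  (1 / (2 * f x)) • (mvfderiv (𝓡 n) f x Y • X + mvfderiv (𝓡 n) f x X • Y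
    - g.inner x X Y • sharp g x (mvfderiv (𝓡 n) f x))

/-- The component `A^l_{ij} = dx^l(A(∂_i, ∂_j))`. -/
def compA (g : Metric n M) (f : M → ℝ) (e : OpenPartialHomeomorph M (Eucl n)) (x : M)
    (l i j : Fin n) : ℝ :=
  coordForm e l x (tensorA g f x (coordVec e i x) (coordVec e j x))

/-- The partial derivative `f_i = ∂f/∂x^i`. -/
def pd (f : M → ℝ) (e : OpenPartialHomeomorph M (Eucl n)) (x : M) (i : Fin n) : ℝ :=
  mvfderiv (𝓡 n) f x (coordVec e i x)

end Base

section Cotangent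

variable {n : ℕ} {M : Type*} [TopologicalSpace M] [ChartedSpace (Eucl n) M]
  [IsManifold (𝓡 n) ∞ M]

/-- The fibre coordinate `p_i = p(∂_i)` on `T*M` of a chart `e` of `M`. -/
def pLow (e : OpenPartialHomeomorph M (Eucl n)) (P : CotangentBundle n M) (i : Fin n) : ℝ :=
  P.snd (coordVec e i P.proj)

/-- `p^i = g^{it} p_t`. -/
def pUp (g : Metric n M) (e : OpenPartialHomeomorph M (Eucl n)) (P : CotangentBundle n M)
    (i : Fin n) : ℝ :=
  ∑ t, gUp g e P.proj i t * pLow e P t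

/-- The induced coordinates `(x^1, …, x^n, p_1, …, p_n)` on `T*M` of a chart `e` of `M`. -/
def inducedCoord (e : OpenPartialHomeomorph M (Eucl n)) (P : CotangentBundle n M) :
    Eucl n × (Fin n → ℝ) :=
  (e P.proj, pLow e P)

/-- The natural frame vector field `∂/∂x^i` of the induced coordinates. -/
def natX (e : OpenPartialHomeomorph M (Eucl n)) (i : Fin n) (P : CotangentBundle n M) :
    TangentSpace (cotModel n) P :=
  VectorField.mpullback (cotModel n) 𝓘(ℝ, Eucl n × (Fin n → ℝ)) (inducedCoord e)
    (fun _ ↦ ((EuclideanSpace.single i (1 : ℝ), 0) : Eucl n × (Fin n → ℝ))) P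

/-- The natural frame vector field `∂/∂p_i` of the induced coordinates. -/
def natP (e : OpenPartialHomeomorph M (Eucl n)) (i : Fin n) (P : CotangentBundle n M) :
    TangentSpace (cotModel n) P :=
  VectorField.mpullback (cotModel n) 𝓘(ℝ, Eucl n × (Fin n → ℝ)) (inducedCoord e)
    (fun _ ↦ ((0, Pi.single i (1 : ℝ)) : Eucl n × (Fin n → ℝ))) P

/-- The frame field `E_j = ∂/∂x^j + p_a Γ^a_{hj} ∂/∂p_h`, the horizontal lift of `∂_j`. -/
def frameH (D : Connection n M) (e : OpenPartialHomeomorph M (Eucl n)) (j : Fin n)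
    (P : CotangentBundle n M) : TangentSpace (cotModel n) P :=
  natX e j P + ∑ h, (∑ a, pLow e P a * Gam D e P.proj a h j) • natP e h P

/-- The frame field `E_{n+j} = ∂/∂p_j`, the vertical lift of `dx^j`. -/
def frameV (e : OpenPartialHomeomorph M (Eucl n)) (j : Fin n) (P : CotangentBundle n M) :
    TangentSpace (cotModel n) P :=
  natP e j P

/-- The horizontal part of a tangent vector `ξ` of `T*M`: the vector `dπ(ξ)` of `M`. -/
def horPart (P : CotangentBundle n M) (ξ : TangentSpace (cotModel n) P) :
    TangentSpace (𝓡 n) P.proj :=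
  mfderiv (cotModel n) (𝓡 n) (TotalSpace.proj : CotangentBundle n M → M) P ξ

/-- The vertical part of a tangent vector `ξ` of `T*M` with respect to `∇`: the covector
`(dp_i(ξ) - p(∇_{dπ(ξ)} ∂_i)) dx^i`, written in a chart `e` around the base point. It does not
depend on `e`. Every `ξ` is the sum of the horizontal lift of `horPart P ξ` and the vertical lift
of this covector. -/
def vertPartIn (D : Connection n M) (e : OpenPartialHomeomorph M (Eucl n))
    (P : CotangentBundle n M) (ξ : TangentSpace (cotModel n) P) : Cotangent n P.proj :=
  ∑ i, (mvfderiv (cotModel n) (fun Q : CotangentBundle n M ↦ pLow e Q i) P ξ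
    - P.snd (D (coordVec e i) P.proj (horPart P ξ))) • coordForm e i P.proj

/-- The vertical part, written in the preferred chart at the base point. -/
def vertPart (D : Connection n M) (P : CotangentBundle n M) (ξ : TangentSpace (cotModel n) P) :
    Cotangent n P.proj :=
  vertPartIn D (chartAt (Eucl n) P.proj) P ξ

/-- `α = 1 + g⁻¹(p, p)`. -/
def alpha (g : Metric n M) (P : CotangentBundle n M) : ℝ := 1 + gInv g P.proj P.snd P.snd

/-- The rescaled Cheeger-Gromoll type metric on `T*M`: `f g` on horizontal lifts,
`(g⁻¹(w, θ) + g⁻¹(w, p) g⁻¹(θ, p)) / α` on vertical lifts of `w` and `θ`, and horizontal lifts are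
orthogonal to vertical lifts. -/
def cgMetric (g : Metric n M) (D : Connection n M) (f : M → ℝ) (P : CotangentBundle n M)
    (ξ η : TangentSpace (cotModel n) P) : ℝ :=
  f P.proj * g.inner P.proj (horPart P ξ) (horPart P η)
    + 1 / alpha g P * (gInv g P.proj (vertPart D P ξ) (vertPart D P η)
      + gInv g P.proj (vertPart D P ξ) P.snd * gInv g P.proj (vertPart D P η) P.snd)

end Cotangent

end CheegerGromoll

end

/-!
The adapted frame `E_1, …, E_{2n}` over a chart consists of the fields `E_j` (`frameH`) and
`E_{n+j}` (`frameV`). Write the right-hand sides of the formulas as vectors `C_{ab}`, the claimed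
values of the derivative of `E_b` along `E_a`. Two facts about them are needed.

* `comb_chris_sub_comb_chris`: `C_{ab} - C_{ba} = [E_a, E_b]`. The brackets are
  `[E_i, E_j] = p_s R_{ijl}^s E_{n+l}` and `[E_i, E_{n+j}] = -Γ^j_{il} E_{n+l}`, and the vertical
  fields commute (`conn_frameH_frameH_sub`, `conn_frameV_frameH_sub`, `conn_frameV_frameV_comm`).
* `comb_chris_metric`: `E_a (G(E_b, E_c)) = G(C_{ab}, E_c) + G(E_b, C_{ac})` for the Cheeger-Gromoll
  type metric `G`. Its Gram matrix in the frame has the blocks `f g_{ij}`, `0` and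
  `h^{ij} = (g^{ij} + p^i p^j) / α`. Along horizontal vectors `α` is constant and `h` is parallel
  (`hasDirDeriv_alpha_frameH`, `hasMatDeriv_hUp_frameH`), since `∇g = 0`. The mixed
  terms cancel by the symmetries of the curvature (`RmM_skew`, `RmM_transpose_mul`), the
  horizontal ones by the definition of the tensor `A` (`sum_compA_mul_gLow`).

The Levi-Civita connection of `G` has the same two properties, so the components
`S_{abc} = G(D'_{E_a} E_b - C_{ab}, E_c)` are symmetric in `a`, `b` and skew in `b`, `c`. Such an
array vanishes, and `G` is positive definite, whence the formulas (`conn_frame`).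

The calculus behind this uses directional derivatives of scalar and of matrix-valued functions
(`HasDirDeriv`, `HasMatDeriv`), and coordinate fields as pullbacks of constant fields
(`constField`), whose brackets vanish. The differential of the induced coordinates on `T*M` is
invertible because they have an explicit smooth inverse (`ofCoord`). The frame components of
tangent vectors of `T*M` are read off from `horPart` and `vertPart`, once the latter is known not
to depend on the chart (`vertPartIn_eq`).
-/

open scoped Topology

noncomputable section

namespace CheegerGromoll

/-! ### Directional derivatives and coordinate fields -/

section Generic

variable {V : Type*} [NormedAddCommGroup V] [NormedSpace ℝ V]
  {H : Type*} [TopologicalSpace H] {I : ModelWithCorners ℝ V H}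
  {N : Type*} [TopologicalSpace N] [ChartedSpace H N]

/-- The real function `F` is differentiable at `x` and its derivative in direction `ξ` is `d`. -/
structure HasDirDeriv (I : ModelWithCorners ℝ V H) (F : N → ℝ) (x : N) (ξ : TangentSpace I x)
    (d : ℝ) : Prop where
  mdiff : MDifferentiableAt I 𝓘(ℝ, ℝ) F x
  eq : mvfderiv I F x ξ = d

namespace HasDirDeriv

variable {F G : N → ℝ} {x : N} {ξ : TangentSpace I x} {c d : ℝ}

lemma of_mdiff (h : MDifferentiableAt I 𝓘(ℝ, ℝ) F x) :
    HasDirDeriv I F x ξ (mvfderiv I F x ξ) := ⟨h, rfl⟩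

lemma const (c : ℝ) : HasDirDeriv I (fun _ : N ↦ c) x ξ 0 :=
  ⟨mdifferentiableAt_const, by rw [mvfderiv_const]; rfl⟩

lemma add (hF : HasDirDeriv I F x ξ c) (hG : HasDirDeriv I G x ξ d) :
    HasDirDeriv I (fun y ↦ F y + G y) x ξ (c + d) :=
  ⟨hF.1.add hG.1, by
    have := mvfderiv_fun_add hF.1 hG.1
    rw [this, ← hF.2, ← hG.2]; rfl⟩

lemma mul (hF : HasDirDeriv I F x ξ c) (hG : HasDirDeriv I G x ξ d) :
    HasDirDeriv I (fun y ↦ F y * G y) x ξ (c * G x + F x * d) :=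
  ⟨hF.1.mul hG.1, by
    have := mvfderiv_fun_mul hF.1 hG.1
    rw [this, ← hF.2, ← hG.2]; simp; ring⟩

lemma congr' (hF : HasDirDeriv I F x ξ c) (h : G =ᶠ[𝓝 x] F) : HasDirDeriv I G x ξ c :=
  ⟨hF.1.congr_of_eventuallyEq h, by
    rw [← hF.2]; simp only [mvfderiv]; rw [h.mfderiv_eq]; simp; rfl⟩

lemma unique (hF : HasDirDeriv I F x ξ c) (hG : HasDirDeriv I F x ξ d) : c = d :=
  hF.2.symm.trans hG.2

lemma congr_val (hF : HasDirDeriv I F x ξ c) (h : c = d) : HasDirDeriv I F x ξ d := h ▸ hF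

lemma sum {ι : Type*} (s : Finset ι) {F : ι → N → ℝ} {c : ι → ℝ}
    (h : ∀ i ∈ s, HasDirDeriv I (F i) x ξ (c i)) :
    HasDirDeriv I (fun y ↦ ∑ i ∈ s, F i y) x ξ (∑ i ∈ s, c i) := by
  classical
  induction s using Finset.induction_on with
  | empty => simpa using const 0
  | insert a s ha ih =>
    simp only [Finset.sum_insert ha]
    exact (h a (by simp)).add (ih fun i hi ↦ h i (by simp [hi]))

lemma inv (hF : HasDirDeriv I F x ξ c) (h0 : F x ≠ 0) :
    HasDirDeriv I (fun y ↦ (F y)⁻¹) x ξ (-c / F x ^ 2) := by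
  have hd : MDifferentiableAt I 𝓘(ℝ, ℝ) (fun y ↦ (F y)⁻¹) x :=
    MDifferentiableAt.comp (I' := 𝓘(ℝ, ℝ)) x (g := fun t : ℝ ↦ t⁻¹)
      (differentiableAt_inv h0).mdifferentiableAt hF.1
  -- The value of the derivative follows by differentiating `F * F⁻¹ = 1`.
  have h1 : HasDirDeriv I (fun y ↦ F y * (F y)⁻¹) x ξ 0 :=
    (const 1).congr' (by
      filter_upwards [hF.1.continuousAt.eventually_ne h0] with y hy
      exact mul_inv_cancel₀ hy)
  have h2 := (hF.mul (of_mdiff hd (ξ := ξ))).unique h1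
  refine ⟨hd, ?_⟩
  field_simp at h2 ⊢
  linarith

lemma comp {V' : Type*} [NormedAddCommGroup V'] [NormedSpace ℝ V'] {H' : Type*}
    [TopologicalSpace H'] {I' : ModelWithCorners ℝ V' H'} {N' : Type*} [TopologicalSpace N']
    [ChartedSpace H' N'] {φ : N' → ℝ} {Φ : N → N'} (hΦ : MDifferentiableAt I I' Φ x)
    (hφ : HasDirDeriv I' φ (Φ x) (mfderiv I I' Φ x ξ) c) :
    HasDirDeriv I (fun y ↦ φ (Φ y)) x ξ c :=
  ⟨hφ.1.comp x hΦ, by rw [← hφ.2]; exact mvfderiv_comp_apply x hφ.1 hΦ ξ⟩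

end HasDirDeriv

/-- Entrywise directional derivative of a matrix-valued function. -/
def HasMatDeriv {m k : Type*} (I : ModelWithCorners ℝ V H) (A : N → Matrix m k ℝ) (x : N)
    (ξ : TangentSpace I x) (A' : Matrix m k ℝ) : Prop :=
  ∀ i j, HasDirDeriv I (fun y ↦ A y i j) x ξ (A' i j)

namespace HasMatDeriv

variable {m k l : Type*} {x : N} {ξ : TangentSpace I x}

lemma mul [Fintype k] {A : N → Matrix m k ℝ} {B : N → Matrix k l ℝ} {A' : Matrix m k ℝ}
    {B' : Matrix k l ℝ} (hA : HasMatDeriv I A x ξ A') (hB : HasMatDeriv I B x ξ B') :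
    HasMatDeriv I (fun y ↦ A y * B y) x ξ (A' * B x + A x * B') := by
  intro i j
  simp only [Matrix.mul_apply, Matrix.add_apply, ← Finset.sum_add_distrib]
  exact HasDirDeriv.sum _ fun a _ ↦ (hA i a).mul (hB a j)

lemma add {A B : N → Matrix m k ℝ} {A' B' : Matrix m k ℝ}
    (hA : HasMatDeriv I A x ξ A') (hB : HasMatDeriv I B x ξ B') :
    HasMatDeriv I (fun y ↦ A y + B y) x ξ (A' + B') := fun i j ↦ (hA i j).add (hB i j)

lemma transpose {A : N → Matrix m k ℝ} {A' : Matrix m k ℝ} (hA : HasMatDeriv I A x ξ A') :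
    HasMatDeriv I (fun y ↦ (A y).transpose) x ξ A'.transpose := fun i j ↦ hA j i

lemma congr' {A B : N → Matrix m k ℝ} {A' : Matrix m k ℝ} (hA : HasMatDeriv I A x ξ A')
    (h : B =ᶠ[𝓝 x] A) : HasMatDeriv I B x ξ A' :=
  fun i j ↦ (hA i j).congr' (by filter_upwards [h] with y hy; rw [hy])

lemma unique {A : N → Matrix m k ℝ} {A' B' : Matrix m k ℝ}
    (hA : HasMatDeriv I A x ξ A') (hB : HasMatDeriv I A x ξ B') : A' = B' := by
  ext i j; exact (hA i j).unique (hB i j)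

lemma mdiff_det {ι : Type*} [Fintype ι] [DecidableEq ι] {A : N → Matrix ι ι ℝ}
    (hA : ∀ i j, MDifferentiableAt I 𝓘(ℝ, ℝ) (fun y ↦ A y i j) x) :
    MDifferentiableAt I 𝓘(ℝ, ℝ) (fun y ↦ (A y).det) x := by
  have h : ∀ (σ : Equiv.Perm ι) (s : Finset ι),
      MDifferentiableAt I 𝓘(ℝ, ℝ) (fun y ↦ ∏ i ∈ s, A y (σ i) i) x := by
    classical
    intro σ s
    induction s using Finset.induction_on with
    | empty => simpa using mdifferentiableAt_const
    | insert a s ha ih =>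
      simp only [Finset.prod_insert ha]
      exact (hA _ _).mul ih
  simp only [Matrix.det_apply']
  exact (HasDirDeriv.sum (ξ := 0) (c := fun σ ↦ _) _ fun σ _ ↦
    .of_mdiff (mdifferentiableAt_const.mul (h σ _))).1

lemma mdiff_inv {ι : Type*} [Fintype ι] [DecidableEq ι] {A : N → Matrix ι ι ℝ}
    (hA : ∀ i j, MDifferentiableAt I 𝓘(ℝ, ℝ) (fun y ↦ A y i j) x) (h0 : (A x).det ≠ 0) (i j : ι) :
    MDifferentiableAt I 𝓘(ℝ, ℝ) (fun y ↦ (A y)⁻¹ i j) x := by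
  have h1 := (HasDirDeriv.of_mdiff (ξ := 0) (mdiff_det hA)).inv h0
  have h2 : MDifferentiableAt I 𝓘(ℝ, ℝ) (fun y ↦ (A y).adjugate i j) x := by
    simp only [Matrix.adjugate_apply]
    apply mdiff_det
    intro a b
    by_cases h : a = j
    · subst h; simp only [Matrix.updateRow_self]; exact mdifferentiableAt_const
    · simp only [Matrix.updateRow_ne h]; exact hA a b
  simp only [Matrix.inv_def, Ring.inverse_eq_inv', Matrix.smul_apply, smul_eq_mul]
  exact h1.1.mul h2

lemma inv {ι : Type*} [Fintype ι] [DecidableEq ι] {A : N → Matrix ι ι ℝ} {A' : Matrix ι ι ℝ}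
    (hA : HasMatDeriv I A x ξ A') (h0 : ∀ᶠ y in 𝓝 x, (A y).det ≠ 0) :
    HasMatDeriv I (fun y ↦ (A y)⁻¹) x ξ (-((A x)⁻¹ * A' * (A x)⁻¹)) := by
  set B' : Matrix ι ι ℝ := fun i j ↦ mvfderiv I (fun y ↦ (A y)⁻¹ i j) x ξ
  have hB : HasMatDeriv I (fun y ↦ (A y)⁻¹) x ξ B' := fun i j ↦
    HasDirDeriv.of_mdiff (mdiff_inv (fun i j ↦ (hA i j).1) h0.self_of_nhds i j)
  -- The value of the derivative follows by differentiating `A * A⁻¹ = 1`.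
  have h1 : HasMatDeriv I (fun y ↦ A y * (A y)⁻¹) x ξ 0 := by
    have : HasMatDeriv I (fun _ : N ↦ (1 : Matrix ι ι ℝ)) x ξ 0 := fun i j ↦ HasDirDeriv.const _
    refine this.congr' ?_
    filter_upwards [h0] with y hy
    exact Matrix.mul_nonsing_inv _ (isUnit_iff_ne_zero.2 hy)
  have h2 := (hA.mul hB).unique h1
  have h3 : B' = -((A x)⁻¹ * A' * (A x)⁻¹) := by
    have hu : IsUnit (A x).det := isUnit_iff_ne_zero.2 h0.self_of_nhds
    rw [eq_neg_iff_add_eq_zero, add_comm]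
    have := congrArg (fun C ↦ (A x)⁻¹ * C) h2
    simpa [mul_add, Matrix.mul_assoc, Matrix.nonsing_inv_mul_cancel_left _ _ hu] using this
  rwa [← h3]

end HasMatDeriv

section Linearity

variable {x : N} (F : N → ℝ)

lemma mvfderiv_add_right (ξ η : TangentSpace I x) :
    mvfderiv I F x (ξ + η) = mvfderiv I F x ξ + mvfderiv I F x η := map_add _ _ _

lemma mvfderiv_smul_right (c : ℝ) (ξ : TangentSpace I x) :
    mvfderiv I F x (c • ξ) = c * mvfderiv I F x ξ := map_smul _ _ _

lemma mvfderiv_sum_right {ι : Type*} (s : Finset ι) (ξ : ι → TangentSpace I x) :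
    mvfderiv I F x (∑ i ∈ s, ξ i) = ∑ i ∈ s, mvfderiv I F x (ξ i) := map_sum _ _ _

variable {V' : Type*} [NormedAddCommGroup V'] [NormedSpace ℝ V'] {H' : Type*}
  [TopologicalSpace H'] (I' : ModelWithCorners ℝ V' H') {N' : Type*} [TopologicalSpace N']
  [ChartedSpace H' N'] (Φ : N → N')

lemma mfderiv_add_right (ξ η : TangentSpace I x) :
    mfderiv I I' Φ x (ξ + η) = mfderiv I I' Φ x ξ + mfderiv I I' Φ x η := map_add _ _ _

lemma mfderiv_smul_right (c : ℝ) (ξ : TangentSpace I x) :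
    mfderiv I I' Φ x (c • ξ) = c • mfderiv I I' Φ x ξ := map_smul _ _ _

lemma mfderiv_sum_right {ι : Type*} (s : Finset ι) (ξ : ι → TangentSpace I x) :
    mfderiv I I' Φ x (∑ i ∈ s, ξ i) = ∑ i ∈ s, mfderiv I I' Φ x (ξ i) := map_sum _ _ _

end Linearity

section Coordinates

variable {F : Type*} [NormedAddCommGroup F] [NormedSpace ℝ F]

/-- The vector field with constant components `v` in the coordinates `Φ`. -/
def constField (I : ModelWithCorners ℝ V H) (Φ : N → F) (v : F) (x : N) : TangentSpace I x :=
  VectorField.mpullback I 𝓘(ℝ, F) Φ (fun _ ↦ v) x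

variable {Φ : N → F} {x : N}

/-- The constant field `v` differentiates a linear function `L` of the coordinates to `L v`. -/
lemma hasDirDeriv_constField (hΦ : MDifferentiableAt I 𝓘(ℝ, F) Φ x)
    (hi : (mfderiv I 𝓘(ℝ, F) Φ x).IsInvertible) (L : F →L[ℝ] ℝ) (v : F) :
    HasDirDeriv I (fun y ↦ L (Φ y)) x (constField I Φ v x) (L v) := by
  refine HasDirDeriv.comp (φ := L) (I' := 𝓘(ℝ, F)) hΦ ⟨L.mdifferentiableAt, ?_⟩
  have h1 : mfderiv I 𝓘(ℝ, F) Φ x (constField I Φ v x) = v := by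
    simp only [constField]
    exact hi.self_apply_inverse _
  rw [h1]
  simp only [mvfderiv, mfderiv_eq_fderiv]
  rw [ContinuousLinearMap.fderiv]
  rfl

/-- Where the coordinates have invertible differential, linear functions of them separate tangent
vectors. -/
lemma eq_of_mfderiv_eq (hi : (mfderiv I 𝓘(ℝ, F) Φ x).IsInvertible) {ξ η : TangentSpace I x}
    (hΦ : MDifferentiableAt I 𝓘(ℝ, F) Φ x)
    (h : ∀ L : F →L[ℝ] ℝ, mvfderiv I (fun y ↦ L (Φ y)) x ξ = mvfderiv I (fun y ↦ L (Φ y)) x η) :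
    ξ = η := by
  have key : ∀ (L : F →L[ℝ] ℝ) (ζ : TangentSpace I x),
      mvfderiv I (fun y ↦ L (Φ y)) x ζ = L (mfderiv I 𝓘(ℝ, F) Φ x ζ) := by
    intro L ζ
    have h1 := mvfderiv_comp_apply x (f := Φ) (g := L) L.mdifferentiableAt hΦ ζ
    simp only [mvfderiv, mfderiv_eq_fderiv, ContinuousLinearMap.fderiv] at h1
    exact h1
  apply hi.injective
  have : ∀ L : F →L[ℝ] ℝ, L (mfderiv I 𝓘(ℝ, F) Φ x ξ) = L (mfderiv I 𝓘(ℝ, F) Φ x η) :=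
    fun L ↦ by rw [← key, ← key, h]
  exact (SeparatingDual.eq_iff_forall_dual_eq (V := F) (R := ℝ)).2 this

lemma contMDiffAt_constField [CompleteSpace V] [IsManifold I ∞ N]
    (hΦ : ContMDiffAt I 𝓘(ℝ, F) ∞ Φ x)
    (hi : (mfderiv I 𝓘(ℝ, F) Φ x).IsInvertible) (v : F) :
    ContMDiffAt I I.tangent ∞ (fun y ↦ (⟨y, constField I Φ v y⟩ : TangentBundle I N)) x := by
  have : IsManifold I 1 N := IsManifold.of_le (n := ∞) (by simp)
  refine ContMDiffAt.mpullback_vectorField_preimage (n := ∞) ?_ hΦ hi le_rfl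
  exact contMDiffAt_vectorSpace_iff_contDiffAt.2 contDiffAt_const

lemma mlieBracket_constField [CompleteSpace V] [CompleteSpace F] [IsManifold I ∞ N]
    (hΦ : ContMDiffAt I 𝓘(ℝ, F) ∞ Φ x) (v w : F) :
    VectorField.mlieBracket I (constField I Φ v) (constField I Φ w) x = 0 := by
  have : IsManifold I (minSmoothness ℝ 3) N := IsManifold.of_le (n := ∞) (by
    simp only [minSmoothness_of_isRCLikeNormedField]; exact ENat.LEInfty.out)
  have hc : ∀ u : F, MDifferentiableAt 𝓘(ℝ, F) 𝓘(ℝ, F).tangent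
      (fun y ↦ (⟨y, u⟩ : TangentBundle 𝓘(ℝ, F) F)) (Φ x) := fun u ↦
    (contMDiffAt_vectorSpace_iff_contDiffAt.2
      (contDiffAt_const (n := 1))).mdifferentiableAt one_ne_zero
  have h := VectorField.mpullback_mlieBracket (n := ∞) (hc v) (hc w) hΦ (by
    simp only [minSmoothness_of_isRCLikeNormedField]; exact ENat.LEInfty.out)
  refine Eq.trans h.symm ?_
  have h0 : ∀ X Y : ∀ z : F, TangentSpace 𝓘(ℝ, F) z, X = (fun _ ↦ v) → Y = (fun _ ↦ w) →
      VectorField.mlieBracket 𝓘(ℝ, F) X Y (Φ x) = 0 := by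
    intro X Y hX hY
    rw [← VectorField.mlieBracketWithin_univ, VectorField.mlieBracketWithin_eq_lieBracketWithin]
    have hb : VectorField.lieBracketWithin ℝ (fun _ : F ↦ v) (fun _ ↦ w) Set.univ (Φ x) = 0 := by
      simp [VectorField.lieBracketWithin_univ, VectorField.lieBracket_eq]
    subst hX hY
    exact hb
  exact (congrArg _ (h0 _ _ rfl rfl)).trans (map_zero _)

/-- A map with a differentiable local inverse has invertible differential. -/
lemma isInvertible_mfderiv_of_inverse {Ψ : F → N} {z : F}
    (hΦ : MDifferentiableAt I 𝓘(ℝ, F) Φ (Ψ z))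
    (hΨ : MDifferentiableAt 𝓘(ℝ, F) I Ψ z) (h1 : ∀ᶠ y in 𝓝 (Ψ z), Ψ (Φ y) = y)
    (h2 : ∀ᶠ t in 𝓝 z, Φ (Ψ t) = t) : (mfderiv I 𝓘(ℝ, F) Φ (Ψ z)).IsInvertible := by
  have hz : Φ (Ψ z) = z := h2.self_of_nhds
  have hl : (mfderiv I 𝓘(ℝ, F) Φ (Ψ z)).comp (mfderiv 𝓘(ℝ, F) I Ψ z) =
      ContinuousLinearMap.id ℝ (TangentSpace 𝓘(ℝ, F) z) := by
    rw [← mfderiv_comp z hΦ hΨ, ← mfderiv_id]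
    exact Filter.EventuallyEq.mfderiv_eq h2
  have hr : (mfderiv 𝓘(ℝ, F) I Ψ (Φ (Ψ z))).comp (mfderiv I 𝓘(ℝ, F) Φ (Ψ z)) =
      ContinuousLinearMap.id ℝ (TangentSpace I (Ψ z)) := by
    rw [← mfderiv_comp (Ψ z) (by rwa [hz]) hΦ, ← mfderiv_id]
    exact Filter.EventuallyEq.mfderiv_eq h1
  refine ContinuousLinearMap.IsInvertible.of_inverse
    (g := (mfderiv 𝓘(ℝ, F) I Ψ z : F →L[ℝ] V)) hl ?_
  rw [hz] at hr
  exact hr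

/-- Second derivatives along coordinate fields commute. -/
lemma mvfderiv_constField_comm [FiniteDimensional ℝ F] {ψ : F → ℝ} {φ : N → ℝ}
    (hΦ : ∀ᶠ y in 𝓝 x, MDifferentiableAt I 𝓘(ℝ, F) Φ y)
    (hi : ∀ᶠ y in 𝓝 x, (mfderiv I 𝓘(ℝ, F) Φ y).IsInvertible)
    (hψ : ContDiffAt ℝ ∞ ψ (Φ x)) (hφ : ∀ᶠ y in 𝓝 x, φ y = ψ (Φ y)) (v w : F) :
    ∃ c : ℝ, HasDirDeriv I (fun y ↦ mvfderiv I φ y (constField I Φ w y)) x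
        (constField I Φ v x) c ∧
      HasDirDeriv I (fun y ↦ mvfderiv I φ y (constField I Φ v y)) x (constField I Φ w x) c := by
  have hs : ∀ u : F, ∀ᶠ y in 𝓝 x,
      mvfderiv I φ y (constField I Φ u y) = fderiv ℝ ψ (Φ y) u := by
    intro u
    have hd : ∀ᶠ z in 𝓝 (Φ x), DifferentiableAt ℝ ψ z :=
      ((hψ.of_le (m := 1) (by simp)).eventually (by simp)).mono fun z hz ↦
        hz.differentiableAt (by simp)
    filter_upwards [hΦ, hi, hφ.eventually_nhds,
      hΦ.self_of_nhds.continuousAt.eventually hd] with y h1 h2 h3 h4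
    have h5 : HasDirDeriv I (fun y ↦ ψ (Φ y)) y (constField I Φ u y) (fderiv ℝ ψ (Φ y) u) := by
      refine HasDirDeriv.comp (I' := 𝓘(ℝ, F)) h1 ⟨h4.mdifferentiableAt, ?_⟩
      have : mfderiv I 𝓘(ℝ, F) Φ y (constField I Φ u y) = u := h2.self_apply_inverse _
      rw [this]
      simp only [mvfderiv, mfderiv_eq_fderiv]
      rfl
    exact (h5.congr' h3).2
  have hsymm : IsSymmSndFDerivAt ℝ ψ (Φ x) :=
    hψ.isSymmSndFDerivAt (by
      simp only [minSmoothness_of_isRCLikeNormedField]; exact ENat.LEInfty.out)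
  have hdd : DifferentiableAt ℝ (fderiv ℝ ψ) (Φ x) :=
    (hψ.fderiv_right (m := 1) (by norm_cast)).differentiableAt (by simp)
  have key : ∀ u t : F, HasDirDeriv I (fun y ↦ mvfderiv I φ y (constField I Φ u y)) x
      (constField I Φ t x) (fderiv ℝ (fderiv ℝ ψ) (Φ x) t u) := by
    intro u t
    refine HasDirDeriv.congr' ?_ (hs u)
    refine HasDirDeriv.comp (I' := 𝓘(ℝ, F)) (φ := fun z ↦ fderiv ℝ ψ z u) hΦ.self_of_nhds
      ⟨(hdd.clm_apply (differentiableAt_const u)).mdifferentiableAt, ?_⟩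
    have : mfderiv I 𝓘(ℝ, F) Φ x (constField I Φ t x) = t := hi.self_of_nhds.self_apply_inverse _
    rw [this]
    simp only [mvfderiv, mfderiv_eq_fderiv]
    change fderiv ℝ (fun z ↦ fderiv ℝ ψ z u) (Φ x) t = _
    rw [fderiv_clm_apply hdd (differentiableAt_const u)]
    simp
  exact ⟨_, key w v, (key v w).congr_val (hsymm.eq _ _)⟩

end Coordinates

end Generic

/-! ### Coordinate frames and the metric on the base -/

section BaseLemmas

variable {n : ℕ} {M : Type*} [TopologicalSpace M] {e : OpenPartialHomeomorph M (Eucl n)} {x : M}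

lemma eventually_mem_source (hx : x ∈ e.source) : ∀ᶠ y in 𝓝 x, y ∈ e.source :=
  e.open_source.mem_nhds hx

variable [ChartedSpace (Eucl n) M]

lemma contMDiffAt_chart (he : e ∈ IsManifold.maximalAtlas (𝓡 n) ∞ M) (hx : x ∈ e.source) :
    ContMDiffAt (𝓡 n) 𝓘(ℝ, Eucl n) ∞ e x := contMDiffAt_of_mem_maximalAtlas he hx

lemma contMDiffAt_chart_symm (he : e ∈ IsManifold.maximalAtlas (𝓡 n) ∞ M) (hx : x ∈ e.source) :
    ContMDiffAt 𝓘(ℝ, Eucl n) (𝓡 n) ∞ e.symm (e x) :=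
  contMDiffAt_symm_of_mem_maximalAtlas he (e.map_source hx)

lemma mdifferentiableAt_chart (he : e ∈ IsManifold.maximalAtlas (𝓡 n) ∞ M) (hx : x ∈ e.source) :
    MDifferentiableAt (𝓡 n) 𝓘(ℝ, Eucl n) e x :=
  (contMDiffAt_chart he hx).mdifferentiableAt (by simp)

lemma isInvertible_mfderiv_chart (he : e ∈ IsManifold.maximalAtlas (𝓡 n) ∞ M)
    (hx : x ∈ e.source) : (mfderiv (𝓡 n) 𝓘(ℝ, Eucl n) e x).IsInvertible := by
  have h := isInvertible_mfderiv_of_inverse (I := 𝓡 n) (Φ := e) (Ψ := e.symm) (z := e x)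
  rw [e.left_inv hx] at h
  refine h (mdifferentiableAt_chart he hx)
    ((contMDiffAt_chart_symm he hx).mdifferentiableAt (by simp)) ?_ ?_
  · exact e.eventually_left_inverse hx
  · exact e.eventually_right_inverse (e.map_source hx)

lemma coordForm_coordVec (he : e ∈ IsManifold.maximalAtlas (𝓡 n) ∞ M) (hx : x ∈ e.source)
    (k i : Fin n) : coordForm e k x (coordVec e i x) = (1 : Matrix (Fin n) (Fin n) ℝ) k i := by
  have h := (hasDirDeriv_constField (mdifferentiableAt_chart he hx)
    (isInvertible_mfderiv_chart he hx) (EuclideanSpace.proj k)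
    (EuclideanSpace.single i (1 : ℝ))).2
  refine Eq.trans h ?_
  simp [Matrix.one_apply]

lemma mdifferentiableAt_chart_apply (he : e ∈ IsManifold.maximalAtlas (𝓡 n) ∞ M)
    (hx : x ∈ e.source) (k : Fin n) :
    MDifferentiableAt (𝓡 n) 𝓘(ℝ, ℝ) (fun y ↦ e y k) x :=
  (hasDirDeriv_constField (mdifferentiableAt_chart he hx)
    (isInvertible_mfderiv_chart he hx) (EuclideanSpace.proj k) 0).1

/-- Tangent vectors of `M` are determined by their components. -/
lemma ext_coordForm (he : e ∈ IsManifold.maximalAtlas (𝓡 n) ∞ M) (hx : x ∈ e.source)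
    {v w : TangentSpace (𝓡 n) x} (h : ∀ k, coordForm e k x v = coordForm e k x w) : v = w := by
  refine eq_of_mfderiv_eq (isInvertible_mfderiv_chart he hx) (mdifferentiableAt_chart he hx) ?_
  intro L
  have key : ∀ ξ : TangentSpace (𝓡 n) x, HasDirDeriv (𝓡 n) (fun y ↦ L (e y)) x ξ
      (∑ k, (0 * e x k + L (EuclideanSpace.single k 1) * coordForm e k x ξ)) := by
    intro ξ
    have h1 := HasDirDeriv.sum (I := 𝓡 n) (x := x) (ξ := ξ) Finset.univ fun k _ ↦
      (HasDirDeriv.const (L (EuclideanSpace.single k 1))).mul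
        (HasDirDeriv.of_mdiff (mdifferentiableAt_chart_apply he hx k))
    refine h1.congr' (.of_forall fun y ↦ ?_)
    change L (e y) = _
    conv_lhs => rw [← (EuclideanSpace.basisFun (Fin n) ℝ).sum_repr (e y)]
    simp [mul_comm]
  rw [(key v).2, (key w).2]
  simp only [h]

lemma sum_coordVec (he : e ∈ IsManifold.maximalAtlas (𝓡 n) ∞ M) (hx : x ∈ e.source)
    (v : TangentSpace (𝓡 n) x) : v = ∑ k, coordForm e k x v • coordVec e k x := by
  refine ext_coordForm he hx fun l ↦ ?_
  simp [coordForm_coordVec he hx, Matrix.one_apply]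

lemma sum_coordForm (he : e ∈ IsManifold.maximalAtlas (𝓡 n) ∞ M) (hx : x ∈ e.source)
    (θ : Cotangent n x) : θ = ∑ k, θ (coordVec e k x) • coordForm e k x := by
  ext v
  conv_lhs => rw [sum_coordVec he hx v]
  simp [mul_comm]

lemma ext_cotangent (he : e ∈ IsManifold.maximalAtlas (𝓡 n) ∞ M) (hx : x ∈ e.source)
    {θ η : Cotangent n x} (h : ∀ k, θ (coordVec e k x) = η (coordVec e k x)) : θ = η := by
  rw [sum_coordForm he hx θ, sum_coordForm he hx η]; simp only [h]

variable [IsManifold (𝓡 n) ∞ M]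

lemma contMDiffAt_coordVec (he : e ∈ IsManifold.maximalAtlas (𝓡 n) ∞ M) (hx : x ∈ e.source)
    (i : Fin n) : ContMDiffAt (𝓡 n) (𝓡 n).tangent ∞
      (fun y ↦ (⟨y, coordVec e i y⟩ : TangentBundle (𝓡 n) M)) x :=
  contMDiffAt_constField (contMDiffAt_chart he hx) (isInvertible_mfderiv_chart he hx) _

lemma mdifferentiableAt_coordVec (he : e ∈ IsManifold.maximalAtlas (𝓡 n) ∞ M)
    (hx : x ∈ e.source) (i : Fin n) : MDifferentiableAt (𝓡 n) (𝓡 n).tangent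
      (fun y ↦ (⟨y, coordVec e i y⟩ : TangentBundle (𝓡 n) M)) x :=
  (contMDiffAt_coordVec he hx i).mdifferentiableAt (by simp)

lemma mlieBracket_coordVec (he : e ∈ IsManifold.maximalAtlas (𝓡 n) ∞ M) (hx : x ∈ e.source)
    (i j : Fin n) : VectorField.mlieBracket (𝓡 n) (coordVec e i) (coordVec e j) x = 0 :=
  mlieBracket_constField (contMDiffAt_chart he hx) _ _

/-- The one-forms `dx^k` are smooth sections of the cotangent bundle. -/
lemma contMDiffAt_coordForm (he : e ∈ IsManifold.maximalAtlas (𝓡 n) ∞ M) (hx : x ∈ e.source)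
    (k : Fin n) : ContMDiffAt (𝓡 n) (cotModel n) ∞
      (fun y ↦ (⟨y, coordForm e k y⟩ : CotangentBundle n M)) x := by
  refine (contMDiffAt_hom_bundle _).2 ⟨contMDiffAt_id, ?_⟩
  have hc : ContMDiffAt (𝓡 n) 𝓘(ℝ, ℝ) ∞ (fun y ↦ e y k) x :=
    ((EuclideanSpace.proj k : Eucl n →L[ℝ] ℝ).contDiff.contMDiff.contMDiffAt).comp x
      (contMDiffAt_chart he hx)
  have h := ContMDiffAt.mfderiv_const (m := ∞) hc (by simp)
  refine h.congr_of_eventuallyEq (.of_forall fun y ↦ ?_)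
  ext v
  simp [inTangentCoordinates, ContinuousLinearMap.inCoordinates, coordForm, mvfderiv]
  rfl

end BaseLemmas

section MetricLemmas

variable {n : ℕ} {M : Type*} [TopologicalSpace M] [ChartedSpace (Eucl n) M]
  [IsManifold (𝓡 n) ∞ M] {e : OpenPartialHomeomorph M (Eucl n)} {x : M} (g : Metric n M)

lemma contMDiffAt_gLow (he : e ∈ IsManifold.maximalAtlas (𝓡 n) ∞ M) (hx : x ∈ e.source)
    (i j : Fin n) : ContMDiffAt (𝓡 n) 𝓘(ℝ, ℝ) ∞ (fun y ↦ gLow g e y i j) x := by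
  have h := ContMDiffAt.clm_bundle_apply₂ (F₁ := Eucl n) (F₂ := Eucl n) (F₃ := ℝ)
    (E₃ := Bundle.Trivial M ℝ) (b := id)
    (g.contMDiff.contMDiffAt (x := x)) (contMDiffAt_coordVec he hx i)
    (contMDiffAt_coordVec he hx j)
  simp only [contMDiffAt_totalSpace] at h
  exact h.2

lemma gLow_comm (i j : Fin n) : gLow g e x i j = gLow g e x j i := g.symm _ _ _

lemma gLow_transpose : (gLow g e x).transpose = gLow g e x := by
  ext i j; exact gLow_comm g _ _

lemma inner_eq_sum (he : e ∈ IsManifold.maximalAtlas (𝓡 n) ∞ M) (hx : x ∈ e.source)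
    (v w : TangentSpace (𝓡 n) x) : g.inner x v w =
      ∑ i, ∑ j, gLow g e x i j * coordForm e i x v * coordForm e j x w := by
  conv_lhs => rw [sum_coordVec he hx v, sum_coordVec he hx w]
  simp only [map_sum, map_smul, sum_apply, smul_apply, smul_eq_mul, gLow, Matrix.of_apply,
    Finset.mul_sum]
  rw [Finset.sum_comm]
  refine Finset.sum_congr rfl fun i _ ↦ Finset.sum_congr rfl fun j _ ↦ ?_
  ring

lemma det_gLow_ne_zero (he : e ∈ IsManifold.maximalAtlas (𝓡 n) ∞ M) (hx : x ∈ e.source) :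
    (gLow g e x).det ≠ 0 := by
  intro h0
  obtain ⟨v, hv, hgv⟩ := Matrix.exists_mulVec_eq_zero_iff.2 h0
  set w : TangentSpace (𝓡 n) x := ∑ k, v k • coordVec e k x with hw
  have hk : ∀ k, coordForm e k x w = v k := fun k ↦ by
    simp [hw, coordForm_coordVec he hx, Matrix.one_apply]
  have hw0 : w ≠ 0 := by
    intro h
    apply hv
    ext k
    rw [← hk, h]; simp
  have := g.pos x w hw0
  rw [inner_eq_sum g he hx] at this
  simp only [hk] at this
  have h2 : ∑ i, ∑ j, gLow g e x i j * v i * v j = 0 := by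
    refine Finset.sum_eq_zero fun i _ ↦ ?_
    have := congrFun hgv i
    simp only [Matrix.mulVec, dotProduct, Pi.zero_apply] at this
    calc _ = v i * ∑ j, gLow g e x i j * v j := by
          rw [Finset.mul_sum]; exact Finset.sum_congr rfl fun j _ ↦ by ring
      _ = 0 := by rw [this, mul_zero]
  linarith

lemma gUp_mul_gLow (he : e ∈ IsManifold.maximalAtlas (𝓡 n) ∞ M) (hx : x ∈ e.source) :
    gUp g e x * gLow g e x = 1 :=
  Matrix.nonsing_inv_mul _ (isUnit_iff_ne_zero.2 (det_gLow_ne_zero g he hx))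

lemma gLow_mul_gUp (he : e ∈ IsManifold.maximalAtlas (𝓡 n) ∞ M) (hx : x ∈ e.source) :
    gLow g e x * gUp g e x = 1 :=
  Matrix.mul_nonsing_inv _ (isUnit_iff_ne_zero.2 (det_gLow_ne_zero g he hx))

lemma gUp_transpose : (gUp g e x).transpose = gUp g e x := by
  rw [gUp, Matrix.transpose_nonsing_inv, gLow_transpose]

lemma gUp_comm (i j : Fin n) : gUp g e x i j = gUp g e x j i :=
  congrFun (congrFun (gUp_transpose g (e := e) (x := x)) j) i

/-- A positive definite bilinear form on a finite-dimensional space identifies it with its dual. -/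
lemma isInvertible_of_pos {E : Type*} [NormedAddCommGroup E] [NormedSpace ℝ E]
    [FiniteDimensional ℝ E] (B : E →L[ℝ] E →L[ℝ] ℝ) (hB : ∀ v, v ≠ 0 → 0 < B v v) :
    B.IsInvertible := by
  have hinj : Function.Injective B.toLinearMap := by
    rw [injective_iff_map_eq_zero]
    intro v hv
    by_contra h
    have := hB v h
    rw [show B v = 0 from hv] at this
    simp at this
  have hfin : Module.finrank ℝ E = Module.finrank ℝ (E →L[ℝ] ℝ) := by
    rw [← (LinearMap.toContinuousLinearMap (𝕜 := ℝ) (E := E) (F' := ℝ)).finrank_eq]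
    exact (Subspace.dual_finrank_eq (K := ℝ) (V := E)).symm
  refine ⟨(LinearMap.linearEquivOfInjective B.toLinearMap hinj hfin).toContinuousLinearEquiv, ?_⟩
  ext v w
  rfl

lemma isInvertible_inner : (g.inner x).IsInvertible :=
  isInvertible_of_pos (E := Eucl n) (g.inner x) (g.pos x)

lemma inner_sharp (θ : Cotangent n x) (v : TangentSpace (𝓡 n) x) :
    g.inner x (sharp g x θ) v = θ v := by
  rw [sharp, (isInvertible_inner g).self_apply_inverse]

lemma coordForm_sharp (he : e ∈ IsManifold.maximalAtlas (𝓡 n) ∞ M) (hx : x ∈ e.source)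
    (θ : Cotangent n x) (l : Fin n) :
    coordForm e l x (sharp g x θ) = ∑ m, gUp g e x l m * θ (coordVec e m x) := by
  have h1 : ∀ m, θ (coordVec e m x) = ∑ k, gLow g e x m k * coordForm e k x (sharp g x θ) := by
    intro m
    rw [← inner_sharp g θ, g.symm, inner_eq_sum g he hx]
    simp [coordForm_coordVec he hx, Matrix.one_apply]
  have h2 : (fun m ↦ θ (coordVec e m x)) =
      (gLow g e x).mulVec fun k ↦ coordForm e k x (sharp g x θ) := funext h1
  have h3 := congrArg (gUp g e x).mulVec h2
  rw [Matrix.mulVec_mulVec, gUp_mul_gLow g he hx, Matrix.one_mulVec] at h3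
  exact (congrFun h3 l).symm

lemma gInv_eq_sum (he : e ∈ IsManifold.maximalAtlas (𝓡 n) ∞ M) (hx : x ∈ e.source)
    (w θ : Cotangent n x) :
    gInv g x w θ = ∑ i, ∑ j, gUp g e x i j * w (coordVec e i x) * θ (coordVec e j x) := by
  rw [gInv]
  conv_lhs => rw [sum_coordVec he hx (sharp g x θ)]
  simp only [map_sum, map_smul, smul_eq_mul, coordForm_sharp g he hx, Finset.sum_mul]
  exact Finset.sum_congr rfl fun i _ ↦ Finset.sum_congr rfl fun j _ ↦ by ring

end MetricLemmas

/-! ### Connections: Christoffel symbols and curvature in coordinates -/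

section LeibnizSum

variable {V : Type*} [NormedAddCommGroup V] [NormedSpace ℝ V]
  {H : Type*} [TopologicalSpace H] {I : ModelWithCorners ℝ V H}
  {N : Type*} [TopologicalSpace N] [ChartedSpace H N] [IsManifold I 1 N]
  (D : CovariantDerivative I V (TangentSpace I : N → Type _)) {x : N}

lemma mdifferentiableAt_sum_smul {ι : Type*} (s : Finset ι) {c : ι → N → ℝ}
    {X : ι → ∀ y : N, TangentSpace I y} (hc : ∀ a ∈ s, MDifferentiableAt I 𝓘(ℝ, ℝ) (c a) x)
    (hX : ∀ a ∈ s, MDifferentiableAt I I.tangent (fun y ↦ (⟨y, X a y⟩ : TangentBundle I N)) x) :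
    MDifferentiableAt I I.tangent
      (fun y ↦ (⟨y, ∑ a ∈ s, c a y • X a y⟩ : TangentBundle I N)) x :=
  MDifferentiableAt.sum_section fun a ha ↦ (hc a ha).smul_section (hX a ha)

/-- The Leibniz rule for a linear combination of vector fields. -/
lemma conn_sum_smul {ι : Type*} (s : Finset ι) {c : ι → N → ℝ}
    {X : ι → ∀ y : N, TangentSpace I y} (hc : ∀ a ∈ s, MDifferentiableAt I 𝓘(ℝ, ℝ) (c a) x)
    (hX : ∀ a ∈ s, MDifferentiableAt I I.tangent (fun y ↦ (⟨y, X a y⟩ : TangentBundle I N)) x)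
    (v : TangentSpace I x) :
    D (fun y ↦ ∑ a ∈ s, c a y • X a y) x v =
      ∑ a ∈ s, (c a x • D (X a) x v + mvfderiv I (c a) x v • X a x) := by
  classical
  induction s using Finset.induction_on with
  | empty =>
    simp only [Finset.sum_empty]
    exact congrArg (fun L ↦ L v) (congrFun D.zero x)
  | insert b s hb ih =>
    have hcb := hc b (by simp)
    have hXb := hX b (by simp)
    have hc' : ∀ a ∈ s, _ := fun a ha ↦ hc a (by simp [ha])
    have hX' : ∀ a ∈ s, _ := fun a ha ↦ hX a (by simp [ha])
    simp only [Finset.sum_insert hb]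
    rw [← ih hc' hX']
    have h1 := D.isCovariantDerivativeOnUniv.add (hcb.smul_section hXb)
      (mdifferentiableAt_sum_smul s hc' hX')
    have h2 := D.isCovariantDerivativeOnUniv.leibniz hXb hcb
    rw [h2] at h1
    exact congrArg (fun L ↦ L v) h1

/-- A connection only depends on the germ of a differentiable vector field. -/
lemma conn_congr {X Y : ∀ y : N, TangentSpace I y} (h : ∀ᶠ y in 𝓝 x, X y = Y y)
    (hY : MDifferentiableAt I I.tangent (fun y ↦ (⟨y, Y y⟩ : TangentBundle I N)) x) :
    D X x = D Y x := by
  refine D.isCovariantDerivativeOnUniv.congr_of_eventuallyEq ?_ hY Filter.univ_mem h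
  exact hY.congr_of_eventuallyEq (h.mono fun y hy ↦ by simp only [hy])

end LeibnizSum

section ConnectionLemmas

variable {n : ℕ} {M : Type*} [TopologicalSpace M] [ChartedSpace (Eucl n) M]
  [IsManifold (𝓡 n) ∞ M] {e : OpenPartialHomeomorph M (Eucl n)} {x : M} {g : Metric n M}
  {D : Connection n M}

/-- The matrix `(Γ_k)^a_b = Γ^a_{kb}` of the connection form in direction `∂_k`. -/
def GamM (D : Connection n M) (e : OpenPartialHomeomorph M (Eucl n)) (x : M) (k : Fin n) :
    Matrix (Fin n) (Fin n) ℝ := Matrix.of fun a b ↦ Gam D e x a k b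

lemma conn_coordVec (he : e ∈ IsManifold.maximalAtlas (𝓡 n) ∞ M) (hx : x ∈ e.source)
    (i j : Fin n) : D (coordVec e j) x (coordVec e i x) = ∑ l, Gam D e x l i j • coordVec e l x :=
  sum_coordVec he hx _

lemma Gam_symm (hD : IsLeviCivita (fun x u v ↦ g.inner x u v) D)
    (he : e ∈ IsManifold.maximalAtlas (𝓡 n) ∞ M) (hx : x ∈ e.source) (l i j : Fin n) :
    Gam D e x l i j = Gam D e x l j i := by
  have h := (CovariantDerivative.torsion_eq_zero_iff D).1 hD.torsion_eq_zero
    (mdifferentiableAt_coordVec he hx i) (mdifferentiableAt_coordVec he hx j)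
  rw [mlieBracket_coordVec he hx, sub_eq_zero] at h
  rw [Gam, Gam, h]

lemma hasMatDeriv_gLow (hD : IsLeviCivita (fun x u v ↦ g.inner x u v) D)
    (he : e ∈ IsManifold.maximalAtlas (𝓡 n) ∞ M) (hx : x ∈ e.source) (k : Fin n) :
    HasMatDeriv (𝓡 n) (gLow g e) x (coordVec e k x)
      ((GamM D e x k).transpose * gLow g e x + gLow g e x * GamM D e x k) := by
  intro i j
  refine ⟨(contMDiffAt_gLow g he hx i j).mdifferentiableAt (by simp), ?_⟩
  refine (hD.metric_compatible x (coordVec e k x) (coordVec e i) (coordVec e j)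
    (mdifferentiableAt_coordVec he hx i) (mdifferentiableAt_coordVec he hx j)).trans ?_
  simp only [conn_coordVec he hx, map_sum, map_smul, sum_apply, smul_apply, smul_eq_mul,
    Matrix.add_apply, Matrix.mul_apply, Matrix.transpose_apply, GamM, gLow, Matrix.of_apply]
  congr 1
  exact Finset.sum_congr rfl fun l _ ↦ mul_comm _ _

lemma hasMatDeriv_gUp (hD : IsLeviCivita (fun x u v ↦ g.inner x u v) D)
    (he : e ∈ IsManifold.maximalAtlas (𝓡 n) ∞ M) (hx : x ∈ e.source) (k : Fin n) :
    HasMatDeriv (𝓡 n) (gUp g e) x (coordVec e k x)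
      (-(gUp g e x * (GamM D e x k).transpose + GamM D e x k * gUp g e x)) := by
  have h := (hasMatDeriv_gLow hD he hx k).inv
    ((eventually_mem_source hx).mono fun y hy ↦ det_gLow_ne_zero g he hy)
  convert! h using 2
  change _ = gUp g e x * _ * gUp g e x
  rw [mul_add, add_mul, ← Matrix.mul_assoc, ← Matrix.mul_assoc, gUp_mul_gLow g he hx, one_mul,
    Matrix.mul_assoc (gUp g e x * _) (gLow g e x), gLow_mul_gUp g he hx, mul_one]

/-- The partial derivatives of the metric coefficients are differentiable and commute. -/
lemma gLow_second_deriv (he : e ∈ IsManifold.maximalAtlas (𝓡 n) ∞ M) (hx : x ∈ e.source)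
    (a b i j : Fin n) : ∃ c : ℝ,
    HasDirDeriv (𝓡 n) (fun y ↦ mvfderiv (𝓡 n) (fun z ↦ gLow g e z a b) y (coordVec e j y)) x
      (coordVec e i x) c ∧
    HasDirDeriv (𝓡 n) (fun y ↦ mvfderiv (𝓡 n) (fun z ↦ gLow g e z a b) y (coordVec e i y)) x
      (coordVec e j x) c := by
  refine mvfderiv_constField_comm (F := Eucl n) (Φ := e)
    (ψ := fun z ↦ gLow g e (e.symm z) a b) ?_ ?_ ?_ ?_ _ _
  · exact (eventually_mem_source hx).mono fun y hy ↦ mdifferentiableAt_chart he hy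
  · exact (eventually_mem_source hx).mono fun y hy ↦ isInvertible_mfderiv_chart he hy
  · rw [← contMDiffAt_iff_contDiffAt]
    refine ContMDiffAt.comp (I' := 𝓡 n) (g := fun y ↦ gLow g e y a b) (e x) ?_
      (contMDiffAt_chart_symm he hx)
    rw [e.left_inv hx]
    exact contMDiffAt_gLow g he hx a b
  · exact (eventually_mem_source hx).mono fun y hy ↦ by rw [e.left_inv hy]

/-- The Koszul formula for the Christoffel symbols. -/
lemma Gam_eq_koszul (hD : IsLeviCivita (fun x u v ↦ g.inner x u v) D)
    (he : e ∈ IsManifold.maximalAtlas (𝓡 n) ∞ M) (hx : x ∈ e.source) (l i j : Fin n) :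
    Gam D e x l i j = ∑ m, gUp g e x l m * (2⁻¹ *
      (mvfderiv (𝓡 n) (fun z ↦ gLow g e z j m) x (coordVec e i x)
        + mvfderiv (𝓡 n) (fun z ↦ gLow g e z i m) x (coordVec e j x)
        - mvfderiv (𝓡 n) (fun z ↦ gLow g e z i j) x (coordVec e m x))) := by
  have hG := fun k a b ↦ (hasMatDeriv_gLow hD he hx k a b).2
  have h1 : ∀ m, 2⁻¹ * (mvfderiv (𝓡 n) (fun z ↦ gLow g e z j m) x (coordVec e i x)
        + mvfderiv (𝓡 n) (fun z ↦ gLow g e z i m) x (coordVec e j x)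
        - mvfderiv (𝓡 n) (fun z ↦ gLow g e z i j) x (coordVec e m x)) =
      ∑ a, gLow g e x m a * Gam D e x a i j := by
    intro m
    rw [hG, hG, hG]
    simp only [Matrix.add_apply, Matrix.mul_apply, Matrix.transpose_apply, GamM, Matrix.of_apply,
      ← Finset.sum_add_distrib, ← Finset.sum_sub_distrib, Finset.mul_sum]
    refine Finset.sum_congr rfl fun a _ ↦ ?_
    rw [Gam_symm hD he hx a j i, Gam_symm hD he hx a m i, Gam_symm hD he hx a m j,
      gLow_comm g a m, gLow_comm g a j]
    ring
  simp only [h1]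
  have h2 : (fun l ↦ Gam D e x l i j) = (gUp g e x).mulVec
      ((gLow g e x).mulVec fun a ↦ Gam D e x a i j) := by
    rw [Matrix.mulVec_mulVec, gUp_mul_gLow g he hx, Matrix.one_mulVec]
  exact congrFun h2 l

/-- The connection is not assumed smooth; its Christoffel symbols are differentiable by the Koszul
formula. -/
lemma mdifferentiableAt_Gam (hD : IsLeviCivita (fun x u v ↦ g.inner x u v) D)
    (he : e ∈ IsManifold.maximalAtlas (𝓡 n) ∞ M) (hx : x ∈ e.source) (l i j : Fin n) :
    MDifferentiableAt (𝓡 n) 𝓘(ℝ, ℝ) (fun y ↦ Gam D e y l i j) x := by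
  have hm : ∀ a b k, MDifferentiableAt (𝓡 n) 𝓘(ℝ, ℝ)
      (fun y ↦ mvfderiv (𝓡 n) (fun z ↦ gLow g e z a b) y (coordVec e k y)) x := fun a b k ↦
    (gLow_second_deriv he hx a b k k).choose_spec.1.1
  have h := HasDirDeriv.sum (I := 𝓡 n) (x := x) (ξ := 0) Finset.univ fun m _ ↦
    ((hasMatDeriv_gUp hD he hx i l m).1.mul (mdifferentiableAt_const (c := (2⁻¹ : ℝ)) |>.mul
      (((hm j m i).add (hm i m j)).sub (hm i j m)))) |> HasDirDeriv.of_mdiff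
  refine h.1.congr_of_eventuallyEq ?_
  filter_upwards [eventually_mem_source hx] with y hy
  exact Gam_eq_koszul hD he hy l i j

/-- The derivative of the matrix `Γ_j` in direction `∂_i`. -/
def dGamM (D : Connection n M) (e : OpenPartialHomeomorph M (Eucl n)) (x : M) (i j : Fin n) :
    Matrix (Fin n) (Fin n) ℝ :=
  Matrix.of fun a b ↦ mvfderiv (𝓡 n) (fun y ↦ Gam D e y a j b) x (coordVec e i x)

lemma hasMatDeriv_GamM (hD : IsLeviCivita (fun x u v ↦ g.inner x u v) D)
    (he : e ∈ IsManifold.maximalAtlas (𝓡 n) ∞ M) (hx : x ∈ e.source) (i j : Fin n) :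
    HasMatDeriv (𝓡 n) (fun y ↦ GamM D e y j) x (coordVec e i x) (dGamM D e x i j) :=
  fun a b ↦ .of_mdiff (mdifferentiableAt_Gam hD he hx a j b)

/-- The curvature matrix `(R_{ij})^s_l = R_{ijl}^s`. -/
def RmM (D : Connection n M) (e : OpenPartialHomeomorph M (Eucl n)) (x : M) (i j : Fin n) :
    Matrix (Fin n) (Fin n) ℝ := Matrix.of fun s l ↦ Rm D e x i j l s

lemma Rm_eq (hD : IsLeviCivita (fun x u v ↦ g.inner x u v) D)
    (he : e ∈ IsManifold.maximalAtlas (𝓡 n) ∞ M) (hx : x ∈ e.source) (i j : Fin n) :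
    RmM D e x i j = dGamM D e x i j - dGamM D e x j i + GamM D e x i * GamM D e x j
      - GamM D e x j * GamM D e x i := by
  have : IsManifold (𝓡 n) 1 M := IsManifold.of_le (n := ∞) (by simp)
  have key : ∀ i j l s, coordForm e s x
      (D (fun y ↦ D (coordVec e l) y (coordVec e j y)) x (coordVec e i x)) =
      ∑ a, (Gam D e x a j l * Gam D e x s i a
        + mvfderiv (𝓡 n) (fun y ↦ Gam D e y a j l) x (coordVec e i x)
          * (1 : Matrix (Fin n) (Fin n) ℝ) s a) := by
    intro i j l s
    have hc := fun a (_ : a ∈ Finset.univ) ↦ mdifferentiableAt_Gam hD he hx a j l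
    have hX := fun a (_ : a ∈ Finset.univ) ↦ mdifferentiableAt_coordVec he hx a
    rw [conn_congr D (Y := fun y ↦ ∑ a, Gam D e y a j l • coordVec e a y)
      ((eventually_mem_source hx).mono fun y hy ↦ conn_coordVec he hy j l)
      (mdifferentiableAt_sum_smul _ hc hX), conn_sum_smul D _ hc hX]
    simp only [map_sum, map_add, map_smul, smul_eq_mul, coordForm_coordVec he hx]
    rfl
  ext s l
  simp only [RmM, Matrix.of_apply, Rm, curvature, mlieBracket_coordVec he hx, map_sub, map_zero,
    sub_zero, key]
  simp only [Finset.sum_add_distrib, Matrix.one_apply, mul_ite, mul_one, mul_zero,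
    Finset.sum_ite_eq, Finset.mem_univ, if_true, Matrix.sub_apply, Matrix.add_apply,
    Matrix.mul_apply, dGamM, GamM, Matrix.of_apply]
  simp only [mul_comm (Gam D e x s _ _)]
  ring

lemma RmM_skew (hD : IsLeviCivita (fun x u v ↦ g.inner x u v) D)
    (he : e ∈ IsManifold.maximalAtlas (𝓡 n) ∞ M) (hx : x ∈ e.source) (i j : Fin n) :
    RmM D e x i j = - RmM D e x j i := by
  rw [Rm_eq hD he hx, Rm_eq hD he hx]; abel

/-- The curvature endomorphisms are skew-adjoint for the metric. -/
lemma RmM_transpose_mul (hD : IsLeviCivita (fun x u v ↦ g.inner x u v) D)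
    (he : e ∈ IsManifold.maximalAtlas (𝓡 n) ∞ M) (hx : x ∈ e.source) (i j : Fin n) :
    (RmM D e x i j).transpose * gLow g e x + gLow g e x * RmM D e x i j = 0 := by
  have key : ∀ i j, HasMatDeriv (𝓡 n)
      (fun y ↦ Matrix.of fun a b ↦ mvfderiv (𝓡 n) (fun z ↦ gLow g e z a b) y (coordVec e j y)) x
      (coordVec e i x)
      ((dGamM D e x i j).transpose * gLow g e x + (GamM D e x j).transpose *
          ((GamM D e x i).transpose * gLow g e x + gLow g e x * GamM D e x i)
        + (((GamM D e x i).transpose * gLow g e x + gLow g e x * GamM D e x i) * GamM D e x j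
          + gLow g e x * dGamM D e x i j)) := by
    intro i j
    have h1 := (((hasMatDeriv_GamM hD he hx i j).transpose).mul (hasMatDeriv_gLow hD he hx i)).add
      ((hasMatDeriv_gLow hD he hx i).mul (hasMatDeriv_GamM hD he hx i j))
    refine h1.congr' ?_
    filter_upwards [eventually_mem_source hx] with y hy
    ext a b
    exact (hasMatDeriv_gLow hD he hy j a b).2
  -- The mixed second derivatives of `g_{ab}` along `∂_i`, `∂_j` agree, and their difference is the
  -- left-hand side of the claim.
  have h : (dGamM D e x i j).transpose * gLow g e x + (GamM D e x j).transpose *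
          ((GamM D e x i).transpose * gLow g e x + gLow g e x * GamM D e x i)
        + (((GamM D e x i).transpose * gLow g e x + gLow g e x * GamM D e x i) * GamM D e x j
          + gLow g e x * dGamM D e x i j) =
      (dGamM D e x j i).transpose * gLow g e x + (GamM D e x i).transpose *
          ((GamM D e x j).transpose * gLow g e x + gLow g e x * GamM D e x j)
        + (((GamM D e x j).transpose * gLow g e x + gLow g e x * GamM D e x j) * GamM D e x i
          + gLow g e x * dGamM D e x j i) := by
    ext a b
    obtain ⟨c, h1, h2⟩ := gLow_second_deriv (g := g) he hx a b i j
    exact (key i j a b).unique h1 |>.trans (h2.unique (key j i a b))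
  rw [← sub_eq_zero] at h
  rw [Rm_eq hD he hx, ← h]
  simp only [Matrix.transpose_add, Matrix.transpose_sub, Matrix.transpose_mul]
  noncomm_ring

lemma compA_eq (he : e ∈ IsManifold.maximalAtlas (𝓡 n) ∞ M) (hx : x ∈ e.source) (f : M → ℝ)
    (l i j : Fin n) : compA g f e x l i j = 1 / (2 * f x) *
      (pd f e x j * (1 : Matrix (Fin n) (Fin n) ℝ) l i
        + pd f e x i * (1 : Matrix (Fin n) (Fin n) ℝ) l j
        - (∑ m, gUp g e x l m * pd f e x m) * gLow g e x i j) := by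
  simp only [compA, tensorA, map_smul, map_add, map_sub, smul_eq_mul, coordForm_coordVec he hx,
    coordForm_sharp g he hx, pd, gLow, Matrix.of_apply]
  ring

/-- `g(A(∂_k, ∂_i), ∂_j) + g(∂_i, A(∂_k, ∂_j)) = (f_k / f) g_{ij}`. -/
lemma sum_compA_mul_gLow (he : e ∈ IsManifold.maximalAtlas (𝓡 n) ∞ M) (hx : x ∈ e.source)
    (f : M → ℝ) (hf : f x ≠ 0) (k i j : Fin n) :
    f x * (∑ l, compA g f e x l k i * gLow g e x l j + ∑ l, gLow g e x i l * compA g f e x l k j)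
      = pd f e x k * gLow g e x i j := by
  have h1 : ∀ i j, ∑ l, gLow g e x j l * compA g f e x l k i = 1 / (2 * f x) *
      (pd f e x i * gLow g e x j k + pd f e x k * gLow g e x j i
        - pd f e x j * gLow g e x k i) := by
    intro i j
    have h2 : ∑ l, gLow g e x j l * ∑ m, gUp g e x l m * pd f e x m = pd f e x j := by
      have : (gLow g e x).mulVec ((gUp g e x).mulVec (pd f e x)) = pd f e x := by
        rw [Matrix.mulVec_mulVec, gLow_mul_gUp g he hx, Matrix.one_mulVec]
      exact congrFun this j
    have h3 : ∀ l, gLow g e x j l * compA g f e x l k i = 1 / (2 * f x) *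
        (pd f e x i * (gLow g e x j l * (1 : Matrix (Fin n) (Fin n) ℝ) l k)
          + pd f e x k * (gLow g e x j l * (1 : Matrix (Fin n) (Fin n) ℝ) l i)
          - (gLow g e x j l * ∑ m, gUp g e x l m * pd f e x m) * gLow g e x k i) := by
      intro l; rw [compA_eq he hx]; ring
    simp only [h3]
    rw [← Finset.mul_sum, Finset.sum_sub_distrib, Finset.sum_add_distrib, ← Finset.mul_sum,
      ← Finset.mul_sum, ← Finset.sum_mul, h2, ← Matrix.mul_apply, ← Matrix.mul_apply, mul_one]
  have h4 : ∑ l, compA g f e x l k i * gLow g e x l j =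
      ∑ l, gLow g e x j l * compA g f e x l k i :=
    Finset.sum_congr rfl fun l _ ↦ by rw [gLow_comm g j l, mul_comm]
  rw [h4, h1, h1, gLow_comm g j k, gLow_comm g j i, gLow_comm g k i]
  field_simp
  ring

end ConnectionLemmas

/-! ### Induced coordinates on the cotangent bundle -/

section CotLemmas

variable {n : ℕ} {M : Type*} [TopologicalSpace M] [ChartedSpace (Eucl n) M]
  {e : OpenPartialHomeomorph M (Eucl n)} {P : CotangentBundle n M}

/-- The point of `T*M` with given induced coordinates. -/
def ofCoord (e : OpenPartialHomeomorph M (Eucl n)) (z : Eucl n × (Fin n → ℝ)) :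
    CotangentBundle n M :=
  ⟨e.symm z.1, ∑ k, z.2 k • coordForm e k (e.symm z.1)⟩

lemma inducedCoord_ofCoord (he : e ∈ IsManifold.maximalAtlas (𝓡 n) ∞ M)
    {z : Eucl n × (Fin n → ℝ)} (hz : z.1 ∈ e.target) : inducedCoord e (ofCoord e z) = z := by
  refine Prod.ext (e.right_inv hz) ?_
  funext i
  simp [inducedCoord, ofCoord, pLow, coordForm_coordVec he (e.map_target hz), Matrix.one_apply]

lemma ofCoord_inducedCoord (he : e ∈ IsManifold.maximalAtlas (𝓡 n) ∞ M)
    (hP : P.proj ∈ e.source) : ofCoord e (inducedCoord e P) = P := by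
  obtain ⟨x, p⟩ := P
  change x ∈ e.source at hP
  have key : ∀ y, y = x → (⟨y, ∑ k, p (coordVec e k x) • coordForm e k y⟩ :
      CotangentBundle n M) = ⟨x, p⟩ := by
    rintro _ rfl
    exact congrArg (TotalSpace.mk _) (sum_coordForm he hP p).symm
  exact key _ (e.left_inv hP)

variable [IsManifold (𝓡 n) ∞ M]

lemma contMDiff_cot_proj : ContMDiff (cotModel n) (𝓡 n) ∞
    (TotalSpace.proj : CotangentBundle n M → M) := Bundle.contMDiff_proj _

lemma mdifferentiableAt_cot_proj : MDifferentiableAt (cotModel n) (𝓡 n)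
    (TotalSpace.proj : CotangentBundle n M → M) P :=
  contMDiff_cot_proj.contMDiffAt.mdifferentiableAt (by simp)

lemma eventually_proj_mem_source (hP : P.proj ∈ e.source) : ∀ᶠ Q in 𝓝 P, Q.proj ∈ e.source :=
  mdifferentiableAt_cot_proj.continuousAt.eventually (e.open_source.mem_nhds hP)

/-- The evaluation of covectors on a smooth vector field is smooth on the cotangent bundle. -/
lemma contMDiffAt_snd_apply {X : ∀ x : M, TangentSpace (𝓡 n) x}
    (hX : ContMDiffAt (𝓡 n) (𝓡 n).tangent ∞ (fun y ↦ (⟨y, X y⟩ : TangentBundle (𝓡 n) M)) P.proj) :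
    ContMDiffAt (cotModel n) 𝓘(ℝ, ℝ) ∞
      (fun Q : CotangentBundle n M ↦ Q.snd (X Q.proj)) P := by
  have h := ContMDiffAt.clm_bundle_apply (F₁ := Eucl n) (F₂ := ℝ) (n := ∞)
    (E₂ := Bundle.Trivial M ℝ) (b := (TotalSpace.proj : CotangentBundle n M → M))
    (IM := cotModel n) (x := P) (ϕ := fun Q : CotangentBundle n M ↦ Q.snd)
    (v := fun Q : CotangentBundle n M ↦ X Q.proj)
    contMDiffAt_id (hX.comp P contMDiff_cot_proj.contMDiffAt)
  simp only [contMDiffAt_totalSpace] at h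
  exact h.2

lemma contMDiffAt_pLow (he : e ∈ IsManifold.maximalAtlas (𝓡 n) ∞ M) (hP : P.proj ∈ e.source)
    (i : Fin n) : ContMDiffAt (cotModel n) 𝓘(ℝ, ℝ) ∞
      (fun Q : CotangentBundle n M ↦ pLow e Q i) P :=
  contMDiffAt_snd_apply (contMDiffAt_coordVec he hP i)

lemma contMDiffAt_inducedCoord (he : e ∈ IsManifold.maximalAtlas (𝓡 n) ∞ M)
    (hP : P.proj ∈ e.source) : ContMDiffAt (cotModel n) 𝓘(ℝ, Eucl n × (Fin n → ℝ)) ∞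
      (inducedCoord (n := n) (M := M) e) P :=
  ((contMDiffAt_chart he hP).comp P contMDiff_cot_proj.contMDiffAt).prodMk_space
    (contMDiffAt_pi_space.2 fun i ↦ contMDiffAt_pLow he hP i)

lemma contMDiffAt_ofCoord (he : e ∈ IsManifold.maximalAtlas (𝓡 n) ∞ M)
    {z : Eucl n × (Fin n → ℝ)} (hz : z.1 ∈ e.target) :
    ContMDiffAt 𝓘(ℝ, Eucl n × (Fin n → ℝ)) (cotModel n) ∞ (ofCoord (M := M) e) z := by
  have h1 : ContMDiffAt 𝓘(ℝ, Eucl n × (Fin n → ℝ)) (𝓡 n) ∞ (fun z ↦ e.symm z.1 :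
      Eucl n × (Fin n → ℝ) → M) z :=
    ContMDiffAt.comp (I' := 𝓘(ℝ, Eucl n)) z (contMDiffAt_symm_of_mem_maximalAtlas he hz)
      contDiff_fst.contMDiff.contMDiffAt
  refine (contMDiffAt_hom_bundle _).2 ⟨h1, ?_⟩
  have h2 : ∀ k, _ := fun k ↦ ((contMDiffAt_hom_bundle _).1
    ((contMDiffAt_coordForm he (e.map_target hz) k).comp z h1)).2
  have h3 : ∀ k : Fin n, ContMDiffAt 𝓘(ℝ, Eucl n × (Fin n → ℝ)) 𝓘(ℝ, ℝ) ∞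
      (fun z : Eucl n × (Fin n → ℝ) ↦ z.2 k) z := fun k ↦
    ((contDiff_apply ℝ ℝ k).comp contDiff_snd).contMDiff.contMDiffAt
  have h4 := contMDiffAt_finsetSum (t := Finset.univ) fun k _ ↦ (h3 k).smul (h2 k)
  refine h4.congr_of_eventuallyEq (.of_forall fun w ↦ ?_)
  ext v
  simp [ContinuousLinearMap.inCoordinates, ofCoord]

lemma isInvertible_mfderiv_inducedCoord (he : e ∈ IsManifold.maximalAtlas (𝓡 n) ∞ M)
    (hP : P.proj ∈ e.source) : (mfderiv (cotModel n) 𝓘(ℝ, Eucl n × (Fin n → ℝ))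
      (inducedCoord (n := n) (M := M) e) P).IsInvertible := by
  have hz : (inducedCoord e P).1 ∈ e.target := e.map_source hP
  have h := isInvertible_mfderiv_of_inverse (I := cotModel n) (Φ := inducedCoord (M := M) e)
    (Ψ := ofCoord e) (z := inducedCoord e P)
  rw [ofCoord_inducedCoord he hP] at h
  refine h ((contMDiffAt_inducedCoord he hP).mdifferentiableAt (by simp))
    ((contMDiffAt_ofCoord he hz).mdifferentiableAt (by simp)) ?_ ?_
  · exact (eventually_proj_mem_source hP).mono fun Q hQ ↦ ofCoord_inducedCoord he hQ
  · have : ∀ᶠ w in 𝓝 (inducedCoord e P), w.1 ∈ e.target :=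
      continuousAt_fst.eventually (e.open_target.mem_nhds hz)
    exact this.mono fun w hw ↦ inducedCoord_ofCoord he hw

end CotLemmas

/-! ### Horizontal and vertical parts of the adapted frame -/

section FrameLemmas

variable {n : ℕ} {M : Type*} [TopologicalSpace M] [ChartedSpace (Eucl n) M]
  [IsManifold (𝓡 n) ∞ M] {e e' : OpenPartialHomeomorph M (Eucl n)} {P : CotangentBundle n M}

lemma hasDirDeriv_proj {φ : M → ℝ} {ξ : TangentSpace (cotModel n) P} {c : ℝ}
    (h : HasDirDeriv (𝓡 n) φ P.proj (horPart P ξ) c) :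
    HasDirDeriv (cotModel n) (fun Q : CotangentBundle n M ↦ φ Q.proj) P ξ c :=
  HasDirDeriv.comp (I' := 𝓡 n) mdifferentiableAt_cot_proj h

lemma mdifferentiableAt_pLow (he : e ∈ IsManifold.maximalAtlas (𝓡 n) ∞ M)
    (hP : P.proj ∈ e.source) (i : Fin n) : MDifferentiableAt (cotModel n) 𝓘(ℝ, ℝ)
      (fun Q : CotangentBundle n M ↦ pLow e Q i) P :=
  (contMDiffAt_pLow he hP i).mdifferentiableAt (by simp)

lemma mdifferentiableAt_inducedCoord (he : e ∈ IsManifold.maximalAtlas (𝓡 n) ∞ M)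
    (hP : P.proj ∈ e.source) : MDifferentiableAt (cotModel n) 𝓘(ℝ, Eucl n × (Fin n → ℝ))
      (inducedCoord (n := n) (M := M) e) P :=
  (contMDiffAt_inducedCoord he hP).mdifferentiableAt (by simp)

lemma coordForm_horPart (he : e ∈ IsManifold.maximalAtlas (𝓡 n) ∞ M) (hP : P.proj ∈ e.source)
    (k : Fin n) (ξ : TangentSpace (cotModel n) P) : coordForm e k P.proj (horPart P ξ) =
      mvfderiv (cotModel n) (fun Q : CotangentBundle n M ↦ e Q.proj k) P ξ :=
  (hasDirDeriv_proj (.of_mdiff (mdifferentiableAt_chart_apply he hP k))).2.symm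

lemma horPart_natX (he : e ∈ IsManifold.maximalAtlas (𝓡 n) ∞ M) (hP : P.proj ∈ e.source)
    (i : Fin n) : horPart P (natX e i P) = coordVec e i P.proj := by
  refine ext_coordForm he hP fun k ↦ ?_
  rw [coordForm_horPart he hP, coordForm_coordVec he hP]
  refine (hasDirDeriv_constField (mdifferentiableAt_inducedCoord he hP)
    (isInvertible_mfderiv_inducedCoord he hP)
    ((EuclideanSpace.proj k : Eucl n →L[ℝ] ℝ).comp (ContinuousLinearMap.fst ℝ _ (Fin n → ℝ)))
    (EuclideanSpace.single i (1 : ℝ), 0)).2.trans ?_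
  simp [Matrix.one_apply]

lemma horPart_natP (he : e ∈ IsManifold.maximalAtlas (𝓡 n) ∞ M) (hP : P.proj ∈ e.source)
    (i : Fin n) : horPart P (natP e i P) = 0 := by
  refine ext_coordForm he hP fun k ↦ ?_
  rw [coordForm_horPart he hP, map_zero]
  refine (hasDirDeriv_constField (mdifferentiableAt_inducedCoord he hP)
    (isInvertible_mfderiv_inducedCoord he hP)
    ((EuclideanSpace.proj k : Eucl n →L[ℝ] ℝ).comp (ContinuousLinearMap.fst ℝ _ (Fin n → ℝ)))
    (0, Pi.single i (1 : ℝ))).2.trans ?_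
  simp

lemma hasDirDeriv_pLow_natX (he : e ∈ IsManifold.maximalAtlas (𝓡 n) ∞ M)
    (hP : P.proj ∈ e.source) (k i : Fin n) : HasDirDeriv (cotModel n)
      (fun Q : CotangentBundle n M ↦ pLow e Q k) P (natX e i P) 0 := by
  refine (hasDirDeriv_constField (mdifferentiableAt_inducedCoord he hP)
    (isInvertible_mfderiv_inducedCoord he hP)
    ((ContinuousLinearMap.proj k : (Fin n → ℝ) →L[ℝ] ℝ).comp
      (ContinuousLinearMap.snd ℝ (Eucl n) (Fin n → ℝ)))
    (EuclideanSpace.single i (1 : ℝ), 0)).congr_val ?_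
  simp

lemma hasDirDeriv_pLow_natP (he : e ∈ IsManifold.maximalAtlas (𝓡 n) ∞ M)
    (hP : P.proj ∈ e.source) (k i : Fin n) : HasDirDeriv (cotModel n)
      (fun Q : CotangentBundle n M ↦ pLow e Q k) P (natP e i P)
      ((1 : Matrix (Fin n) (Fin n) ℝ) k i) := by
  refine (hasDirDeriv_constField (mdifferentiableAt_inducedCoord he hP)
    (isInvertible_mfderiv_inducedCoord he hP)
    ((ContinuousLinearMap.proj k : (Fin n → ℝ) →L[ℝ] ℝ).comp
      (ContinuousLinearMap.snd ℝ (Eucl n) (Fin n → ℝ)))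
    (0, Pi.single i (1 : ℝ))).congr_val ?_
  simp [Matrix.one_apply, Pi.single_apply]

/-- A tangent vector of `T*M` is determined by its projection to `M` and its `dp`-components. -/
lemma ext_horPart_pLow (he : e ∈ IsManifold.maximalAtlas (𝓡 n) ∞ M) (hP : P.proj ∈ e.source)
    {ξ η : TangentSpace (cotModel n) P} (h : horPart P ξ = horPart P η)
    (h' : ∀ k, mvfderiv (cotModel n) (fun Q : CotangentBundle n M ↦ pLow e Q k) P ξ =
      mvfderiv (cotModel n) (fun Q : CotangentBundle n M ↦ pLow e Q k) P η) : ξ = η := by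
  refine eq_of_mfderiv_eq (isInvertible_mfderiv_inducedCoord he hP)
    (mdifferentiableAt_inducedCoord he hP) fun L ↦ ?_
  have h1 : MDifferentiableAt (𝓡 n) 𝓘(ℝ, ℝ) (fun y ↦ L (e y, 0)) P.proj :=
    (L.comp (ContinuousLinearMap.inl ℝ _ _)).mdifferentiableAt.comp P.proj
      (mdifferentiableAt_chart he hP)
  have key : ∀ ζ : TangentSpace (cotModel n) P, HasDirDeriv (cotModel n)
      (fun Q ↦ L (inducedCoord e Q)) P ζ
      (mvfderiv (𝓡 n) (fun y ↦ L (e y, 0)) P.proj (horPart P ζ)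
        + ∑ k, (0 * pLow e P k + L (0, Pi.single k 1) *
          mvfderiv (cotModel n) (fun Q : CotangentBundle n M ↦ pLow e Q k) P ζ)) := by
    intro ζ
    have h2 := (hasDirDeriv_proj (ξ := ζ) (.of_mdiff h1)).add
      (HasDirDeriv.sum Finset.univ fun k _ ↦ (HasDirDeriv.const (L (0, Pi.single k 1))).mul
        (HasDirDeriv.of_mdiff (ξ := ζ) (mdifferentiableAt_pLow he hP k)))
    refine h2.congr' (.of_forall fun Q ↦ ?_)
    have h3 : inducedCoord e Q = (e Q.proj, 0) + ∑ k, pLow e Q k • ((0, Pi.single k 1) :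
        Eucl n × (Fin n → ℝ)) := by
      refine Prod.ext (by simp [inducedCoord, Prod.fst_sum]) ?_
      funext k
      simp [inducedCoord, Prod.snd_sum, Finset.sum_apply, Pi.single_apply]
    change L (inducedCoord e Q) = _
    rw [h3, map_add, map_sum]
    simp only [map_smul, smul_eq_mul, mul_comm]
  rw [(key ξ).2, (key η).2, h]
  simp only [h']

lemma horPart_add (ξ η : TangentSpace (cotModel n) P) :
    horPart P (ξ + η) = horPart P ξ + horPart P η := mfderiv_add_right _ _ _ _

lemma horPart_smul (c : ℝ) (ξ : TangentSpace (cotModel n) P) :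
    horPart P (c • ξ) = c • horPart P ξ := mfderiv_smul_right _ _ _ _

lemma horPart_sum {ι : Type*} (s : Finset ι) (ξ : ι → TangentSpace (cotModel n) P) :
    horPart P (∑ i ∈ s, ξ i) = ∑ i ∈ s, horPart P (ξ i) := mfderiv_sum_right _ _ _ _

variable {D : Connection n M}

lemma horPart_frameH (he : e ∈ IsManifold.maximalAtlas (𝓡 n) ∞ M) (hP : P.proj ∈ e.source)
    (i : Fin n) : horPart P (frameH D e i P) = coordVec e i P.proj := by
  simp [frameH, horPart_add, horPart_sum, horPart_smul, horPart_natX he hP, horPart_natP he hP]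

lemma horPart_frameV (he : e ∈ IsManifold.maximalAtlas (𝓡 n) ∞ M) (hP : P.proj ∈ e.source)
    (i : Fin n) : horPart P (frameV e i P) = 0 := horPart_natP he hP i

lemma hasDirDeriv_pLow_frameH (he : e ∈ IsManifold.maximalAtlas (𝓡 n) ∞ M)
    (hP : P.proj ∈ e.source) (k i : Fin n) : HasDirDeriv (cotModel n)
      (fun Q : CotangentBundle n M ↦ pLow e Q k) P (frameH D e i P)
      (∑ a, pLow e P a * Gam D e P.proj a k i) := by
  refine ⟨mdifferentiableAt_pLow he hP k, ?_⟩
  simp only [frameH, mvfderiv_add_right, mvfderiv_sum_right, mvfderiv_smul_right,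
    (hasDirDeriv_pLow_natX he hP k i).2, (hasDirDeriv_pLow_natP he hP k _).2]
  simp [Matrix.one_apply]

/-- The vertical part does not depend on the chart used to write it. -/
lemma vertPartIn_eq (he : e ∈ IsManifold.maximalAtlas (𝓡 n) ∞ M)
    (he' : e' ∈ IsManifold.maximalAtlas (𝓡 n) ∞ M) (hP : P.proj ∈ e.source)
    (hP' : P.proj ∈ e'.source) (ξ : TangentSpace (cotModel n) P) :
    vertPartIn D e' P ξ = vertPartIn D e P ξ := by
  have : IsManifold (𝓡 n) 1 M := IsManifold.of_le (n := ∞) (by simp)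
  set a : Fin n → Fin n → M → ℝ := fun k i y ↦ coordForm e k y (coordVec e' i y) with ha
  have ham : ∀ k i, MDifferentiableAt (𝓡 n) 𝓘(ℝ, ℝ) (a k i) P.proj := by
    intro k i
    have h := ContMDiffAt.clm_bundle_apply (F₁ := Eucl n) (F₂ := ℝ) (n := ∞)
      (E₂ := Bundle.Trivial M ℝ) (b := id) (contMDiffAt_coordForm he hP k)
      (contMDiffAt_coordVec he' hP' i)
    simp only [contMDiffAt_totalSpace] at h
    exact h.2.mdifferentiableAt (by simp)
  have hp : ∀ i, mvfderiv (cotModel n) (fun Q : CotangentBundle n M ↦ pLow e' Q i) P ξ =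
      ∑ k, (mvfderiv (𝓡 n) (a k i) P.proj (horPart P ξ) * pLow e P k + a k i P.proj *
        mvfderiv (cotModel n) (fun Q : CotangentBundle n M ↦ pLow e Q k) P ξ) := by
    intro i
    have h := HasDirDeriv.sum Finset.univ fun k _ ↦
      (hasDirDeriv_proj (ξ := ξ) (.of_mdiff (ham k i))).mul
        (.of_mdiff (mdifferentiableAt_pLow he hP k))
    refine (h.congr' ?_).2
    filter_upwards [eventually_proj_mem_source hP] with Q hQ
    change Q.snd (coordVec e' i Q.proj) = _
    conv_lhs => rw [sum_coordVec he hQ (coordVec e' i Q.proj)]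
    simp [ha, pLow]
  have hD : ∀ i, D (coordVec e' i) P.proj (horPart P ξ) =
      ∑ k, (a k i P.proj • D (coordVec e k) P.proj (horPart P ξ)
        + mvfderiv (𝓡 n) (a k i) P.proj (horPart P ξ) • coordVec e k P.proj) := by
    intro i
    have hX := fun k (_ : k ∈ Finset.univ) ↦ mdifferentiableAt_coordVec he hP k
    rw [conn_congr D (Y := fun y ↦ ∑ k, a k i y • coordVec e k y)
      ((eventually_mem_source hP).mono fun y hy ↦ sum_coordVec he hy _)
      (mdifferentiableAt_sum_smul _ (fun k _ ↦ ham k i) hX),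
      conn_sum_smul D _ (fun k _ ↦ ham k i) hX]
  have hc : ∀ i, mvfderiv (cotModel n) (fun Q : CotangentBundle n M ↦ pLow e' Q i) P ξ
      - P.snd (D (coordVec e' i) P.proj (horPart P ξ)) =
      ∑ k, a k i P.proj *
        (mvfderiv (cotModel n) (fun Q : CotangentBundle n M ↦ pLow e Q k) P ξ
          - P.snd (D (coordVec e k) P.proj (horPart P ξ))) := by
    intro i
    rw [hp, hD, map_sum, ← Finset.sum_sub_distrib]
    refine Finset.sum_congr rfl fun k _ ↦ ?_
    simp only [map_add, map_smul, smul_eq_mul, pLow]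
    ring
  simp only [vertPartIn, hc]
  calc _ = ∑ i, ∑ k, (mvfderiv (cotModel n) (fun Q : CotangentBundle n M ↦ pLow e Q k) P ξ
          - P.snd (D (coordVec e k) P.proj (horPart P ξ))) •
            (a k i P.proj • coordForm e' i P.proj) := by
        refine Finset.sum_congr rfl fun i _ ↦ ?_
        rw [Finset.sum_smul]
        exact Finset.sum_congr rfl fun k _ ↦ by rw [mul_comm, mul_smul]
    _ = _ := by
        rw [Finset.sum_comm]
        refine Finset.sum_congr rfl fun k _ ↦ ?_
        rw [← Finset.smul_sum, ← sum_coordForm he' hP' (coordForm e k P.proj)]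

lemma vertPart_eq (he : e ∈ IsManifold.maximalAtlas (𝓡 n) ∞ M) (hP : P.proj ∈ e.source)
    (ξ : TangentSpace (cotModel n) P) : vertPart D P ξ = vertPartIn D e P ξ :=
  vertPartIn_eq he (IsManifold.chart_mem_maximalAtlas _) hP (mem_chart_source _ _) ξ

lemma vertPart_apply (he : e ∈ IsManifold.maximalAtlas (𝓡 n) ∞ M) (hP : P.proj ∈ e.source)
    (ξ : TangentSpace (cotModel n) P) (k : Fin n) : vertPart D P ξ (coordVec e k P.proj) =
      mvfderiv (cotModel n) (fun Q : CotangentBundle n M ↦ pLow e Q k) P ξ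
        - P.snd (D (coordVec e k) P.proj (horPart P ξ)) := by
  rw [vertPart_eq he hP, vertPartIn]
  simp [coordForm_coordVec he hP, Matrix.one_apply]

lemma vertPart_add (ξ η : TangentSpace (cotModel n) P) :
    vertPart D P (ξ + η) = vertPart D P ξ + vertPart D P η := by
  refine ext_cotangent (e := chartAt (Eucl n) P.proj) (IsManifold.chart_mem_maximalAtlas _)
    (mem_chart_source _ _) fun k ↦ ?_
  simp only [vertPart_apply (IsManifold.chart_mem_maximalAtlas _) (mem_chart_source _ _),
    add_apply, mvfderiv_add_right, horPart_add]
  rw [map_add, map_add]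
  ring

lemma vertPart_smul (c : ℝ) (ξ : TangentSpace (cotModel n) P) :
    vertPart D P (c • ξ) = c • vertPart D P ξ := by
  refine ext_cotangent (e := chartAt (Eucl n) P.proj) (IsManifold.chart_mem_maximalAtlas _)
    (mem_chart_source _ _) fun k ↦ ?_
  simp only [vertPart_apply (IsManifold.chart_mem_maximalAtlas _) (mem_chart_source _ _),
    smul_apply, mvfderiv_smul_right, horPart_smul, smul_eq_mul]
  rw [map_smul, map_smul, smul_eq_mul]
  ring

lemma vertPart_frameV (he : e ∈ IsManifold.maximalAtlas (𝓡 n) ∞ M) (hP : P.proj ∈ e.source)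
    (i : Fin n) : vertPart D P (frameV e i P) = coordForm e i P.proj := by
  refine ext_cotangent he hP fun k ↦ ?_
  rw [vertPart_apply he hP, horPart_frameV he hP, coordForm_coordVec he hP]
  rw [show frameV e i P = natP e i P from rfl, (hasDirDeriv_pLow_natP he hP k i).2]
  simp [Matrix.one_apply, eq_comm]

lemma vertPart_frameH {g : Metric n M} (hD : IsLeviCivita (fun x u v ↦ g.inner x u v) D)
    (he : e ∈ IsManifold.maximalAtlas (𝓡 n) ∞ M) (hP : P.proj ∈ e.source)
    (i : Fin n) : vertPart D P (frameH D e i P) = 0 := by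
  refine ext_cotangent he hP fun k ↦ ?_
  rw [vertPart_apply he hP, horPart_frameH he hP, (hasDirDeriv_pLow_frameH he hP k i).2,
    conn_coordVec he hP]
  simp only [map_sum, map_smul, smul_eq_mul, zero_apply]
  rw [← Finset.sum_sub_distrib]
  refine Finset.sum_eq_zero fun a _ ↦ ?_
  rw [Gam_symm hD he hP a k i, pLow]; ring

/-- A tangent vector of `T*M` is determined by its horizontal and vertical parts. -/
lemma ext_horPart_vertPart {ξ η : TangentSpace (cotModel n) P} (h : horPart P ξ = horPart P η)
    (h' : vertPart D P ξ = vertPart D P η) : ξ = η := by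
  have he := IsManifold.chart_mem_maximalAtlas (I := 𝓡 n) (n := ∞) P.proj
  have hP := mem_chart_source (Eucl n) P.proj
  refine ext_horPart_pLow he hP h fun k ↦ ?_
  have h1 := congrArg (fun θ : Cotangent n P.proj ↦ θ (coordVec (chartAt (Eucl n) P.proj) k P.proj))
    h'
  simp only [vertPart_apply he hP, h] at h1
  linarith

end FrameLemmas

/-! ### The Cheeger-Gromoll type metric in the adapted frame -/

section CoMetric

variable {n : ℕ} {M : Type*} [TopologicalSpace M] [ChartedSpace (Eucl n) M]
  [IsManifold (𝓡 n) ∞ M] (g : Metric n M) {x : M}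

lemma gInv_comm (w θ : Cotangent n x) : gInv g x w θ = gInv g x θ w := by
  rw [gInv, gInv, ← inner_sharp g w, ← inner_sharp g θ, g.symm]

lemma gInv_add_left (w w' θ : Cotangent n x) :
    gInv g x (w + w') θ = gInv g x w θ + gInv g x w' θ := rfl

lemma gInv_smul_left (c : ℝ) (w θ : Cotangent n x) :
    gInv g x (c • w) θ = c * gInv g x w θ := rfl

lemma gInv_zero_left (θ : Cotangent n x) : gInv g x 0 θ = 0 := rfl

lemma gInv_self_pos {w : Cotangent n x} (hw : w ≠ 0) : 0 < gInv g x w w := by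
  rw [gInv, ← inner_sharp g w]
  refine g.pos x _ fun h ↦ hw ?_
  ext v
  rw [← inner_sharp g w, h]
  simp

lemma gInv_self_nonneg (w : Cotangent n x) : 0 ≤ gInv g x w w := by
  by_cases hw : w = 0
  · rw [hw, gInv_zero_left]
  · exact (gInv_self_pos g hw).le

lemma alpha_pos (P : CotangentBundle n M) : 0 < alpha g P := by
  have := gInv_self_nonneg g P.snd
  rw [alpha]; linarith

end CoMetric

section TotalMetric

variable {n : ℕ} {M : Type*} [TopologicalSpace M] [ChartedSpace (Eucl n) M]
  [IsManifold (𝓡 n) ∞ M] {g : Metric n M} {D : Connection n M} {f : M → ℝ}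
  {e : OpenPartialHomeomorph M (Eucl n)} {P : CotangentBundle n M}

lemma cgMetric_comm (ξ η : TangentSpace (cotModel n) P) :
    cgMetric g D f P ξ η = cgMetric g D f P η ξ := by
  rw [cgMetric, cgMetric, g.symm, gInv_comm g (vertPart D P ξ) (vertPart D P η)]
  ring

lemma cgMetric_add_left (ξ ξ' η : TangentSpace (cotModel n) P) :
    cgMetric g D f P (ξ + ξ') η = cgMetric g D f P ξ η + cgMetric g D f P ξ' η := by
  simp only [cgMetric, horPart_add, vertPart_add, gInv_add_left]
  rw [map_add, add_apply]
  ring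

lemma cgMetric_smul_left (c : ℝ) (ξ η : TangentSpace (cotModel n) P) :
    cgMetric g D f P (c • ξ) η = c * cgMetric g D f P ξ η := by
  simp only [cgMetric, horPart_smul, vertPart_smul, gInv_smul_left]
  rw [map_smul, smul_apply, smul_eq_mul]
  ring

lemma cgMetric_zero_left (η : TangentSpace (cotModel n) P) : cgMetric g D f P 0 η = 0 := by
  have h := cgMetric_smul_left (g := g) (D := D) (f := f) 0 (0 : TangentSpace (cotModel n) P) η
  rwa [zero_smul, zero_mul] at h

lemma cgMetric_sub_left (ξ ξ' η : TangentSpace (cotModel n) P) :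
    cgMetric g D f P (ξ - ξ') η = cgMetric g D f P ξ η - cgMetric g D f P ξ' η := by
  have h := cgMetric_add_left (g := g) (D := D) (f := f) (ξ - ξ') ξ' η
  rw [sub_add_cancel] at h
  linarith

lemma cgMetric_sum_smul_left {ι : Type*} (s : Finset ι) (c : ι → ℝ)
    (ξ : ι → TangentSpace (cotModel n) P) (η : TangentSpace (cotModel n) P) :
    cgMetric g D f P (∑ i ∈ s, c i • ξ i) η = ∑ i ∈ s, c i * cgMetric g D f P (ξ i) η := by
  classical
  induction s using Finset.induction_on with
  | empty => simpa using cgMetric_zero_left η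
  | insert a s ha ih =>
    rw [Finset.sum_insert ha, Finset.sum_insert ha, cgMetric_add_left, cgMetric_smul_left, ih]

lemma vertPart_zero : vertPart D P (0 : TangentSpace (cotModel n) P) = 0 := by
  have h := vertPart_smul (D := D) 0 (0 : TangentSpace (cotModel n) P)
  rwa [zero_smul, zero_smul] at h

lemma vertPart_sum {ι : Type*} (s : Finset ι) (ξ : ι → TangentSpace (cotModel n) P) :
    vertPart D P (∑ i ∈ s, ξ i) = ∑ i ∈ s, vertPart D P (ξ i) := by
  classical
  induction s using Finset.induction_on with
  | empty => simpa using vertPart_zero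
  | insert a s ha ih => rw [Finset.sum_insert ha, Finset.sum_insert ha, vertPart_add, ih]

/-- The metric `cgMetric` is positive definite. -/
lemma eq_zero_of_cgMetric_self (hf : 0 < f P.proj) {ξ : TangentSpace (cotModel n) P}
    (h : cgMetric g D f P ξ ξ = 0) : ξ = 0 := by
  have hα := alpha_pos g P
  have h1 : 0 ≤ g.inner P.proj (horPart P ξ) (horPart P ξ) := by
    by_cases h0 : horPart P ξ = 0
    · rw [h0]; simp
    · exact (g.pos _ _ h0).le
  have h2 := gInv_self_nonneg g (vertPart D P ξ)
  rw [cgMetric] at h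
  have h3 : 0 ≤ 1 / alpha g P * (gInv g P.proj (vertPart D P ξ) (vertPart D P ξ)
      + gInv g P.proj (vertPart D P ξ) P.snd * gInv g P.proj (vertPart D P ξ) P.snd) :=
    mul_nonneg (by positivity) (add_nonneg h2 (mul_self_nonneg _))
  refine ext_horPart_vertPart (D := D) ?_ ?_
  · by_contra h0
    have h00 : horPart P (0 : TangentSpace (cotModel n) P) = 0 :=
      ContinuousLinearMap.map_zero _
    rw [h00] at h0
    have := mul_pos hf (g.pos _ _ h0)
    linarith
  · by_contra h0
    rw [vertPart_zero] at h0
    have h4 : 0 < 1 / alpha g P * (gInv g P.proj (vertPart D P ξ) (vertPart D P ξ)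
        + gInv g P.proj (vertPart D P ξ) P.snd * gInv g P.proj (vertPart D P ξ) P.snd) :=
      mul_pos (by positivity) (add_pos_of_pos_of_nonneg (gInv_self_pos g h0) (mul_self_nonneg _))
    have := mul_nonneg hf.le h1
    linarith

/-- The adapted frame spans every tangent space of `T*M` over the chart domain. -/
lemma eq_sum_frame (hD : IsLeviCivita (fun x u v ↦ g.inner x u v) D)
    (he : e ∈ IsManifold.maximalAtlas (𝓡 n) ∞ M) (hP : P.proj ∈ e.source)
    (ξ : TangentSpace (cotModel n) P) :
    ξ = ∑ l, coordForm e l P.proj (horPart P ξ) • frameH D e l P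
      + ∑ l, vertPart D P ξ (coordVec e l P.proj) • frameV e l P := by
  refine ext_horPart_vertPart (D := D) ?_ ?_
  · simp only [horPart_add, horPart_sum, horPart_smul, horPart_frameH he hP,
      horPart_frameV he hP, smul_zero, Finset.sum_const_zero, add_zero]
    exact sum_coordVec he hP _
  · simp only [vertPart_add, vertPart_sum, vertPart_smul, vertPart_frameH hD he hP,
      vertPart_frameV he hP, smul_zero, Finset.sum_const_zero, zero_add]
    exact sum_coordForm he hP _

/-- A tangent vector of `T*M` orthogonal to the adapted frame vanishes. -/
lemma eq_zero_of_cgMetric_frame (hD : IsLeviCivita (fun x u v ↦ g.inner x u v) D)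
    (he : e ∈ IsManifold.maximalAtlas (𝓡 n) ∞ M) (hP : P.proj ∈ e.source) (hf : 0 < f P.proj)
    {ξ : TangentSpace (cotModel n) P} (hH : ∀ l, cgMetric g D f P ξ (frameH D e l P) = 0)
    (hV : ∀ l, cgMetric g D f P ξ (frameV e l P) = 0) : ξ = 0 := by
  refine eq_zero_of_cgMetric_self (g := g) (D := D) hf ?_
  have h : ∀ η, η = ξ → cgMetric g D f P η ξ = 0 := by
    intro η hη
    rw [eq_sum_frame hD he hP η, cgMetric_add_left, cgMetric_sum_smul_left,
      cgMetric_sum_smul_left]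
    simp only [fun l ↦ (cgMetric_comm (frameH D e l P) ξ).trans (hH l),
      fun l ↦ (cgMetric_comm (frameV e l P) ξ).trans (hV l), mul_zero, Finset.sum_const_zero,
      add_zero]
  exact h ξ rfl

/-- The matrix `h^{ij} = (g^{ij} + p^i p^j) / α` of the metric on vertical vectors. -/
def hUp (g : Metric n M) (e : OpenPartialHomeomorph M (Eucl n)) (P : CotangentBundle n M) :
    Matrix (Fin n) (Fin n) ℝ :=
  Matrix.of fun i j ↦ (gUp g e P.proj i j + pUp g e P i * pUp g e P j) * (alpha g P)⁻¹

lemma gInv_coordForm (he : e ∈ IsManifold.maximalAtlas (𝓡 n) ∞ M) (hP : P.proj ∈ e.source)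
    (i j : Fin n) :
    gInv g P.proj (coordForm e i P.proj) (coordForm e j P.proj) = gUp g e P.proj i j := by
  rw [gInv, coordForm_sharp g he hP]
  simp [coordForm_coordVec he hP, Matrix.one_apply]

lemma gInv_coordForm_snd (he : e ∈ IsManifold.maximalAtlas (𝓡 n) ∞ M) (hP : P.proj ∈ e.source)
    (i : Fin n) : gInv g P.proj (coordForm e i P.proj) P.snd = pUp g e P i := by
  rw [gInv, coordForm_sharp g he hP]; rfl

lemma alpha_eq (he : e ∈ IsManifold.maximalAtlas (𝓡 n) ∞ M) (hP : P.proj ∈ e.source) :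
    alpha g P = 1 + ∑ i, pLow e P i * pUp g e P i := by
  rw [alpha, gInv_eq_sum g he hP]
  simp only [pUp, Finset.mul_sum]
  congr 1
  exact Finset.sum_congr rfl fun i _ ↦ Finset.sum_congr rfl fun j _ ↦ by simp only [pLow]; ring

lemma cgMetric_frameH_frameH (hD : IsLeviCivita (fun x u v ↦ g.inner x u v) D)
    (he : e ∈ IsManifold.maximalAtlas (𝓡 n) ∞ M) (hP : P.proj ∈ e.source) (i j : Fin n) :
    cgMetric g D f P (frameH D e i P) (frameH D e j P) = f P.proj * gLow g e P.proj i j := by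
  rw [cgMetric, horPart_frameH he hP, horPart_frameH he hP, vertPart_frameH hD he hP,
    vertPart_frameH hD he hP, gInv_zero_left, gInv_zero_left]
  simp [gLow]

lemma cgMetric_frameH_frameV (hD : IsLeviCivita (fun x u v ↦ g.inner x u v) D)
    (he : e ∈ IsManifold.maximalAtlas (𝓡 n) ∞ M) (hP : P.proj ∈ e.source) (i j : Fin n) :
    cgMetric g D f P (frameH D e i P) (frameV e j P) = 0 := by
  rw [cgMetric, horPart_frameV he hP, vertPart_frameH hD he hP, gInv_zero_left, gInv_zero_left]
  simp

lemma cgMetric_frameV_frameV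
    (he : e ∈ IsManifold.maximalAtlas (𝓡 n) ∞ M) (hP : P.proj ∈ e.source) (i j : Fin n) :
    cgMetric g D f P (frameV e i P) (frameV e j P) = hUp g e P i j := by
  rw [cgMetric, horPart_frameV he hP, vertPart_frameV he hP, vertPart_frameV he hP,
    gInv_coordForm he hP, gInv_coordForm_snd he hP, gInv_coordForm_snd he hP, map_zero, hUp,
    Matrix.of_apply]
  simp
  ring

/-- The tangent vector `a^l E_l + b_l E_{n+l}`. -/
def comb (D : Connection n M) (e : OpenPartialHomeomorph M (Eucl n)) (P : CotangentBundle n M)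
    (a b : Fin n → ℝ) : TangentSpace (cotModel n) P :=
  ∑ l, a l • frameH D e l P + ∑ l, b l • frameV e l P

lemma cgMetric_comb_frameH (hD : IsLeviCivita (fun x u v ↦ g.inner x u v) D)
    (he : e ∈ IsManifold.maximalAtlas (𝓡 n) ∞ M) (hP : P.proj ∈ e.source) (a b : Fin n → ℝ)
    (j : Fin n) : cgMetric g D f P (comb D e P a b) (frameH D e j P) =
      f P.proj * ∑ l, a l * gLow g e P.proj l j := by
  rw [comb, cgMetric_add_left, cgMetric_sum_smul_left, cgMetric_sum_smul_left, Finset.mul_sum]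
  simp only [cgMetric_frameH_frameH hD he hP, cgMetric_comm (frameV e _ P),
    cgMetric_frameH_frameV hD he hP, mul_zero, Finset.sum_const_zero, add_zero]
  exact Finset.sum_congr rfl fun l _ ↦ by ring

lemma cgMetric_comb_frameV (hD : IsLeviCivita (fun x u v ↦ g.inner x u v) D)
    (he : e ∈ IsManifold.maximalAtlas (𝓡 n) ∞ M) (hP : P.proj ∈ e.source) (a b : Fin n → ℝ)
    (j : Fin n) : cgMetric g D f P (comb D e P a b) (frameV e j P) =
      ∑ l, b l * hUp g e P l j := by
  rw [comb, cgMetric_add_left, cgMetric_sum_smul_left, cgMetric_sum_smul_left]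
  simp only [cgMetric_frameV_frameV he hP, cgMetric_frameH_frameV hD he hP, mul_zero,
    Finset.sum_const_zero, zero_add]

end TotalMetric

/-! ### Derivatives of the metric coefficients along the adapted frame -/

section FrameDerivatives

variable {n : ℕ} {M : Type*} [TopologicalSpace M] [ChartedSpace (Eucl n) M]
  [IsManifold (𝓡 n) ∞ M] {g : Metric n M} {D : Connection n M} {f : M → ℝ}
  {e : OpenPartialHomeomorph M (Eucl n)} {P : CotangentBundle n M}

/-- The fibre coordinates `p_i` as a row matrix. -/
def pRow (e : OpenPartialHomeomorph M (Eucl n)) (P : CotangentBundle n M) :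
    Matrix Unit (Fin n) ℝ := Matrix.of fun _ i ↦ pLow e P i

/-- The raised fibre coordinates `p^i` as a row matrix. -/
def pUpRow (g : Metric n M) (e : OpenPartialHomeomorph M (Eucl n)) (P : CotangentBundle n M) :
    Matrix Unit (Fin n) ℝ := Matrix.of fun _ i ↦ pUp g e P i

lemma pUpRow_eq : pUpRow g e P = pRow e P * gUp g e P.proj := by
  ext u i
  simp only [pUpRow, pRow, pUp, Matrix.mul_apply, Matrix.of_apply]
  exact Finset.sum_congr rfl fun t _ ↦ by rw [gUp_comm g i t, mul_comm]

lemma hUp_eq : hUp g e P = (alpha g P)⁻¹ •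
    (gUp g e P.proj + (pUpRow g e P).transpose * pUpRow g e P) := by
  ext i j
  simp [hUp, pUpRow, Matrix.mul_apply, mul_comm]

lemma hUp_comm (i j : Fin n) : hUp g e P i j = hUp g e P j i := by
  simp only [hUp, Matrix.of_apply, gUp_comm g i j, mul_comm (pUp g e P i)]

/-- `p_l h^{lj} = p^j`. -/
lemma sum_pLow_mul_hUp (he : e ∈ IsManifold.maximalAtlas (𝓡 n) ∞ M) (hP : P.proj ∈ e.source)
    (j : Fin n) : ∑ l, pLow e P l * hUp g e P l j = pUp g e P j := by
  have hα := (alpha_pos g P).ne'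
  have h1 : ∑ l, pLow e P l * gUp g e P.proj l j = pUp g e P j := by
    have := congrFun (congrFun (pUpRow_eq (g := g) (e := e) (P := P)) ()) j
    simpa [pUpRow, pRow, Matrix.mul_apply] using this.symm
  have h2 : ∀ l, pLow e P l * hUp g e P l j = (pLow e P l * gUp g e P.proj l j
      + pLow e P l * pUp g e P l * pUp g e P j) * (alpha g P)⁻¹ := fun l ↦ by
    simp only [hUp, Matrix.of_apply]; ring
  simp only [h2]
  rw [← Finset.sum_mul, Finset.sum_add_distrib, ← Finset.sum_mul, h1]
  have h3 : ∑ l, pLow e P l * pUp g e P l = alpha g P - 1 := by rw [alpha_eq he hP]; ring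
  rw [h3]
  field_simp
  ring

lemma hasMatDeriv_proj {m k : Type*} {A : M → Matrix m k ℝ} {ξ : TangentSpace (cotModel n) P}
    {A' : Matrix m k ℝ} (h : HasMatDeriv (𝓡 n) A P.proj (horPart P ξ) A') :
    HasMatDeriv (cotModel n) (fun Q : CotangentBundle n M ↦ A Q.proj) P ξ A' :=
  fun i j ↦ hasDirDeriv_proj (h i j)

lemma hasMatDeriv_pRow_frameH (hD : IsLeviCivita (fun x u v ↦ g.inner x u v) D)
    (he : e ∈ IsManifold.maximalAtlas (𝓡 n) ∞ M) (hP : P.proj ∈ e.source) (k : Fin n) :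
    HasMatDeriv (cotModel n) (pRow e) P (frameH D e k P)
      (pRow e P * GamM D e P.proj k) := fun _ i ↦ by
  refine (hasDirDeriv_pLow_frameH he hP i k).congr_val ?_
  simp only [pRow, GamM, Matrix.mul_apply, Matrix.of_apply]
  exact Finset.sum_congr rfl fun a _ ↦ by rw [Gam_symm hD he hP a i k]

lemma hasMatDeriv_gUp_frameH (hD : IsLeviCivita (fun x u v ↦ g.inner x u v) D)
    (he : e ∈ IsManifold.maximalAtlas (𝓡 n) ∞ M) (hP : P.proj ∈ e.source) (k : Fin n) :
    HasMatDeriv (cotModel n) (fun Q : CotangentBundle n M ↦ gUp g e Q.proj) P (frameH D e k P)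
      (-(gUp g e P.proj * (GamM D e P.proj k).transpose + GamM D e P.proj k * gUp g e P.proj)) := by
  refine hasMatDeriv_proj ?_
  rw [horPart_frameH he hP]
  exact hasMatDeriv_gUp hD he hP k

lemma hasMatDeriv_pUpRow_frameH (hD : IsLeviCivita (fun x u v ↦ g.inner x u v) D)
    (he : e ∈ IsManifold.maximalAtlas (𝓡 n) ∞ M) (hP : P.proj ∈ e.source) (k : Fin n) :
    HasMatDeriv (cotModel n) (pUpRow g e) P (frameH D e k P)
      (-(pUpRow g e P * (GamM D e P.proj k).transpose)) := by
  have h := ((hasMatDeriv_pRow_frameH hD he hP k).mul (hasMatDeriv_gUp_frameH hD he hP k)).congr'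
    (B := pUpRow g e) (.of_forall fun Q ↦ pUpRow_eq)
  convert! h using 1
  rw [pUpRow_eq]
  simp only [Matrix.mul_add, Matrix.mul_neg, Matrix.mul_assoc]
  abel

/-- `α` is constant along horizontal vectors. -/
lemma hasDirDeriv_alpha_frameH (hD : IsLeviCivita (fun x u v ↦ g.inner x u v) D)
    (he : e ∈ IsManifold.maximalAtlas (𝓡 n) ∞ M) (hP : P.proj ∈ e.source) (k : Fin n) :
    HasDirDeriv (cotModel n) (alpha g) P (frameH D e k P) 0 := by
  have h := (HasDirDeriv.const (1 : ℝ)).add (((hasMatDeriv_pRow_frameH hD he hP k).mul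
    (hasMatDeriv_pUpRow_frameH hD he hP k).transpose) () ())
  refine (h.congr_val ?_).congr' ?_
  · have : pRow e P * GamM D e P.proj k * (pUpRow g e P).transpose +
        pRow e P * (-(pUpRow g e P * (GamM D e P.proj k).transpose)).transpose = 0 := by
      rw [Matrix.transpose_neg, Matrix.transpose_mul, Matrix.transpose_transpose]
      simp only [Matrix.mul_neg, Matrix.mul_assoc]
      abel
    rw [this]; simp
  · filter_upwards [eventually_proj_mem_source hP] with Q hQ
    rw [alpha_eq he hQ, Matrix.mul_apply]
    rfl

/-- The vertical metric matrix `h` is parallel along horizontal vectors. -/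
lemma hasMatDeriv_hUp_frameH (hD : IsLeviCivita (fun x u v ↦ g.inner x u v) D)
    (he : e ∈ IsManifold.maximalAtlas (𝓡 n) ∞ M) (hP : P.proj ∈ e.source) (k : Fin n) :
    HasMatDeriv (cotModel n) (hUp g e) P (frameH D e k P)
      (-(GamM D e P.proj k * hUp g e P + hUp g e P * (GamM D e P.proj k).transpose)) := by
  have h1 := (hasMatDeriv_pUpRow_frameH hD he hP k)
  have h2 := (hasMatDeriv_gUp_frameH hD he hP k).add (h1.transpose.mul h1)
  have hα := (hasDirDeriv_alpha_frameH hD he hP k).inv (alpha_pos g P).ne'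
  intro i j
  refine ((hα.mul (h2 i j)).congr_val ?_).congr' (.of_forall fun Q ↦ ?_)
  · rw [neg_zero, zero_div, zero_mul, zero_add]
    have h3 : -(GamM D e P.proj k * hUp g e P + hUp g e P * (GamM D e P.proj k).transpose) =
      (alpha g P)⁻¹ • (-(gUp g e P.proj * (GamM D e P.proj k).transpose
        + GamM D e P.proj k * gUp g e P.proj)
        + ((-(pUpRow g e P * (GamM D e P.proj k).transpose)).transpose * pUpRow g e P
        + (pUpRow g e P).transpose * -(pUpRow g e P * (GamM D e P.proj k).transpose))) := by
      rw [hUp_eq, Matrix.transpose_neg, Matrix.transpose_mul, Matrix.transpose_transpose,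
        Matrix.mul_smul, Matrix.smul_mul, ← smul_add, ← smul_neg]
      congr 1
      simp only [Matrix.mul_add, Matrix.add_mul, Matrix.mul_neg, Matrix.neg_mul, Matrix.mul_assoc]
      abel
    rw [h3, Matrix.smul_apply, smul_eq_mul]
  · exact congrFun (congrFun (hUp_eq (g := g) (e := e) (P := Q)) i) j

lemma hasDirDeriv_proj_frameV (he : e ∈ IsManifold.maximalAtlas (𝓡 n) ∞ M)
    (hP : P.proj ∈ e.source) {φ : M → ℝ} (hφ : MDifferentiableAt (𝓡 n) 𝓘(ℝ, ℝ) φ P.proj)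
    (k : Fin n) : HasDirDeriv (cotModel n) (fun Q : CotangentBundle n M ↦ φ Q.proj) P
      (frameV e k P) 0 := by
  refine hasDirDeriv_proj ⟨hφ, ?_⟩
  rw [horPart_frameV he hP, map_zero]

lemma mdifferentiableAt_gUp (he : e ∈ IsManifold.maximalAtlas (𝓡 n) ∞ M) (hP : P.proj ∈ e.source)
    (i j : Fin n) : MDifferentiableAt (𝓡 n) 𝓘(ℝ, ℝ) (fun y ↦ gUp g e y i j) P.proj :=
  HasMatDeriv.mdiff_inv
    (fun i j ↦ (contMDiffAt_gLow g he hP i j).mdifferentiableAt (by simp))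
    (det_gLow_ne_zero g he hP) i j

lemma hasDirDeriv_pUp_frameV (he : e ∈ IsManifold.maximalAtlas (𝓡 n) ∞ M)
    (hP : P.proj ∈ e.source) (i k : Fin n) :
    HasDirDeriv (cotModel n) (fun Q ↦ pUp g e Q i) P (frameV e k P) (gUp g e P.proj i k) := by
  refine (HasDirDeriv.sum Finset.univ fun t _ ↦
    (hasDirDeriv_proj_frameV he hP (mdifferentiableAt_gUp he hP i t) k).mul
      (hasDirDeriv_pLow_natP he hP t k)).congr_val ?_
  simp [Matrix.one_apply]

lemma hasDirDeriv_alpha_frameV (he : e ∈ IsManifold.maximalAtlas (𝓡 n) ∞ M)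
    (hP : P.proj ∈ e.source) (k : Fin n) :
    HasDirDeriv (cotModel n) (alpha g) P (frameV e k P) (2 * pUp g e P k) := by
  have h := (HasDirDeriv.const (1 : ℝ)).add (HasDirDeriv.sum Finset.univ fun i _ ↦
    (hasDirDeriv_pLow_natP he hP i k).mul (hasDirDeriv_pUp_frameV (g := g) he hP i k))
  refine (h.congr_val ?_).congr'
    ((eventually_proj_mem_source hP).mono fun Q hQ ↦ alpha_eq he hQ)
  have h1 : ∑ i, pLow e P i * gUp g e P.proj i k = pUp g e P k :=
    Finset.sum_congr rfl fun t _ ↦ by rw [gUp_comm g k t, mul_comm]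
  rw [Finset.sum_add_distrib, h1]
  simp [Matrix.one_apply]
  ring

lemma hasDirDeriv_hUp_frameV (he : e ∈ IsManifold.maximalAtlas (𝓡 n) ∞ M)
    (hP : P.proj ∈ e.source) (i j k : Fin n) :
    HasDirDeriv (cotModel n) (fun Q ↦ hUp g e Q i j) P (frameV e k P)
      ((gUp g e P.proj i k * pUp g e P j + pUp g e P i * gUp g e P.proj j k) * (alpha g P)⁻¹
        + (gUp g e P.proj i j + pUp g e P i * pUp g e P j) *
          (-(2 * pUp g e P k) / alpha g P ^ 2)) := by
  refine ((((hasDirDeriv_proj_frameV he hP (mdifferentiableAt_gUp he hP i j) k).add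
    ((hasDirDeriv_pUp_frameV he hP i k).mul (hasDirDeriv_pUp_frameV he hP j k))).mul
    ((hasDirDeriv_alpha_frameV he hP k).inv (alpha_pos g P).ne'))).congr_val ?_
  simp

end FrameDerivatives

/-! ### Torsion-free connections and brackets of the adapted frame -/

section Torsion

variable {V : Type*} [NormedAddCommGroup V] [NormedSpace ℝ V]
  {H : Type*} [TopologicalSpace H] {I : ModelWithCorners ℝ V H}
  {N : Type*} [TopologicalSpace N] [ChartedSpace H N] [IsManifold I 1 N]
  (D : CovariantDerivative I V (TangentSpace I : N → Type _)) {x : N}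

/-- If the fields `Z₀`, `Z₁`, `W_h` behave under a torsion-free connection as commuting fields do,
then `∇_X Y - ∇_Y X` for `X = Z₀ + c_h W_h` and `Y = Z₁ + d_h W_h` is `(X d_h - Y c_h) W_h`. -/
lemma conn_sub_conn {ι : Type*} [Fintype ι] {Z₀ Z₁ : ∀ y : N, TangentSpace I y}
    {W : ι → ∀ y : N, TangentSpace I y} {c d : ι → N → ℝ}
    (hZ₀ : MDifferentiableAt I I.tangent (fun y ↦ (⟨y, Z₀ y⟩ : TangentBundle I N)) x)
    (hZ₁ : MDifferentiableAt I I.tangent (fun y ↦ (⟨y, Z₁ y⟩ : TangentBundle I N)) x)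
    (hW : ∀ h, MDifferentiableAt I I.tangent (fun y ↦ (⟨y, W h y⟩ : TangentBundle I N)) x)
    (hc : ∀ h, MDifferentiableAt I 𝓘(ℝ, ℝ) (c h) x)
    (hd : ∀ h, MDifferentiableAt I 𝓘(ℝ, ℝ) (d h) x)
    (h01 : D Z₁ x (Z₀ x) = D Z₀ x (Z₁ x)) (h0 : ∀ h, D (W h) x (Z₀ x) = D Z₀ x (W h x))
    (h1 : ∀ h, D (W h) x (Z₁ x) = D Z₁ x (W h x))
    (hWW : ∀ h k, D (W h) x (W k x) = D (W k) x (W h x))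
    {X Y : ∀ y : N, TangentSpace I y} (hX : X = fun y ↦ Z₀ y + ∑ h, c h y • W h y)
    (hY : Y = fun y ↦ Z₁ y + ∑ h, d h y • W h y) :
    D Y x (X x) - D X x (Y x) =
      ∑ h, (mvfderiv I (d h) x (X x) - mvfderiv I (c h) x (Y x)) • W h x := by
  have key : ∀ {Z : ∀ y : N, TangentSpace I y} {b : ι → N → ℝ},
      MDifferentiableAt I I.tangent (fun y ↦ (⟨y, Z y⟩ : TangentBundle I N)) x →
      (∀ h, MDifferentiableAt I 𝓘(ℝ, ℝ) (b h) x) → ∀ v : TangentSpace I x,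
      D (fun y ↦ Z y + ∑ h, b h y • W h y) x v =
        D Z x v + ∑ h, (b h x • D (W h) x v + mvfderiv I (b h) x v • W h x) := by
    intro Z b hZ hb v
    rw [← conn_sum_smul D Finset.univ (fun h _ ↦ hb h) (fun h _ ↦ hW h)]
    have h2 := D.isCovariantDerivativeOnUniv.add hZ
      (mdifferentiableAt_sum_smul Finset.univ (fun h _ ↦ hb h) (fun h _ ↦ hW h))
    exact congrArg (fun L ↦ L v) h2
  have hXx : X x = Z₀ x + ∑ h, c h x • W h x := by rw [hX]
  have hYx : Y x = Z₁ x + ∑ h, d h x • W h x := by rw [hY]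
  have e1 : ∀ (S : ∀ y : N, TangentSpace I y),
      D S x (X x) = D S x (Z₀ x) + ∑ h, c h x • D S x (W h x) := fun S ↦ by
    rw [hXx, map_add, map_sum]; simp only [map_smul]
  have e2 : ∀ (S : ∀ y : N, TangentSpace I y),
      D S x (Y x) = D S x (Z₁ x) + ∑ h, d h x • D S x (W h x) := fun S ↦ by
    rw [hYx, map_add, map_sum]; simp only [map_smul]
  have e3 : D Y x (X x) = D Z₁ x (X x)
      + ∑ h, (d h x • D (W h) x (X x) + mvfderiv I (d h) x (X x) • W h x) := by
    conv_lhs => rw [hY]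
    exact key hZ₁ hd _
  have e4 : D X x (Y x) = D Z₀ x (Y x)
      + ∑ h, (c h x • D (W h) x (Y x) + mvfderiv I (c h) x (Y x) • W h x) := by
    conv_lhs => rw [hX]
    exact key hZ₀ hc _
  rw [e3, e4]
  simp only [e1, e2, h01, h0, h1, smul_add, Finset.sum_add_distrib, Finset.smul_sum, sub_smul,
    Finset.sum_sub_distrib]
  have e5 : ∑ h, ∑ k, d h x • c k x • D (W h) x (W k x) =
      ∑ h, ∑ k, c h x • d k x • D (W h) x (W k x) := by
    rw [Finset.sum_comm]
    refine Finset.sum_congr rfl fun h _ ↦ Finset.sum_congr rfl fun k _ ↦ ?_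
    rw [smul_comm, hWW]
  rw [e5]
  abel

end Torsion

section FrameTorsion

variable {n : ℕ} {M : Type*} [TopologicalSpace M] [ChartedSpace (Eucl n) M]
  [IsManifold (𝓡 n) ∞ M] {g : Metric n M} {D : Connection n M} {f : M → ℝ}
  {D' : CotConnection n M} {e : OpenPartialHomeomorph M (Eucl n)} {P : CotangentBundle n M}

lemma mdifferentiableAt_constField_inducedCoord (he : e ∈ IsManifold.maximalAtlas (𝓡 n) ∞ M)
    (hP : P.proj ∈ e.source) (v : Eucl n × (Fin n → ℝ)) :
    MDifferentiableAt (cotModel n) (cotModel n).tangent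
      (fun Q : CotangentBundle n M ↦ (⟨Q, constField (cotModel n) (inducedCoord e) v Q⟩ :
        TangentBundle (cotModel n) (CotangentBundle n M))) P :=
  (contMDiffAt_constField (contMDiffAt_inducedCoord he hP)
    (isInvertible_mfderiv_inducedCoord he hP) v).mdifferentiableAt (by simp)

lemma conn_constField_comm (hD' : D'.torsion = 0)
    (he : e ∈ IsManifold.maximalAtlas (𝓡 n) ∞ M) (hP : P.proj ∈ e.source)
    (v w : Eucl n × (Fin n → ℝ)) :
    D' (constField (cotModel n) (inducedCoord e) v) P
        (constField (cotModel n) (inducedCoord e) w P) =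
      D' (constField (cotModel n) (inducedCoord e) w) P
        (constField (cotModel n) (inducedCoord e) v P) := by
  have h := (CovariantDerivative.torsion_eq_zero_iff D').1 hD'
    (mdifferentiableAt_constField_inducedCoord he hP w)
    (mdifferentiableAt_constField_inducedCoord he hP v)
  rwa [mlieBracket_constField (contMDiffAt_inducedCoord he hP), sub_eq_zero] at h

/-- The coefficients `p_a Γ^a_{hj}` of the horizontal frame, as functions on `T*M`. -/
def horCoeff (D : Connection n M) (e : OpenPartialHomeomorph M (Eucl n)) (j h : Fin n)
    (Q : CotangentBundle n M) : ℝ := ∑ a, pLow e Q a * Gam D e Q.proj a h j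

lemma hasDirDeriv_horCoeff_frameH (hD : IsLeviCivita (fun x u v ↦ g.inner x u v) D)
    (he : e ∈ IsManifold.maximalAtlas (𝓡 n) ∞ M) (hP : P.proj ∈ e.source) (i j h : Fin n) :
    HasDirDeriv (cotModel n) (horCoeff D e j h) P (frameH D e i P)
      ((pRow e P * GamM D e P.proj i * GamM D e P.proj j + pRow e P * dGamM D e P.proj i j)
        () h) := by
  have h1 : HasMatDeriv (cotModel n) (fun Q : CotangentBundle n M ↦ GamM D e Q.proj j) P
      (frameH D e i P) (dGamM D e P.proj i j) := by
    refine hasMatDeriv_proj (A := fun y ↦ GamM D e y j) ?_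
    rw [horPart_frameH he hP]
    exact hasMatDeriv_GamM hD he hP i j
  refine (((hasMatDeriv_pRow_frameH hD he hP i).mul h1) () h).congr' ?_
  filter_upwards [eventually_proj_mem_source hP] with Q hQ
  rw [Matrix.mul_apply]
  exact Finset.sum_congr rfl fun a _ ↦ by rw [Gam_symm hD he hQ a h j]; rfl

lemma hasDirDeriv_horCoeff_frameV (hD : IsLeviCivita (fun x u v ↦ g.inner x u v) D)
    (he : e ∈ IsManifold.maximalAtlas (𝓡 n) ∞ M) (hP : P.proj ∈ e.source) (i j h : Fin n) :
    HasDirDeriv (cotModel n) (horCoeff D e j h) P (frameV e i P) (Gam D e P.proj i h j) := by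
  refine (HasDirDeriv.sum Finset.univ fun a _ ↦ (hasDirDeriv_pLow_natP he hP a i).mul
    (hasDirDeriv_proj_frameV he hP (mdifferentiableAt_Gam hD he hP a h j) i)).congr_val ?_
  simp [Matrix.one_apply]

lemma frameH_eq (j : Fin n) : frameH D e j =
    fun Q ↦ natX e j Q + ∑ h, horCoeff D e j h Q • natP e h Q := rfl

lemma mdifferentiableAt_frameH (hD : IsLeviCivita (fun x u v ↦ g.inner x u v) D)
    (he : e ∈ IsManifold.maximalAtlas (𝓡 n) ∞ M) (hP : P.proj ∈ e.source) (j : Fin n) :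
    MDifferentiableAt (cotModel n) (cotModel n).tangent
      (fun Q : CotangentBundle n M ↦ (⟨Q, frameH D e j Q⟩ :
        TangentBundle (cotModel n) (CotangentBundle n M))) P := by
  have : IsManifold (cotModel n) 1 (CotangentBundle n M) := IsManifold.of_le (n := ∞) (by simp)
  exact mdifferentiableAt_add_section (mdifferentiableAt_constField_inducedCoord he hP _)
    (mdifferentiableAt_sum_smul Finset.univ
      (fun h _ ↦ (hasDirDeriv_horCoeff_frameV hD he hP j j h).1)
      fun h _ ↦ mdifferentiableAt_constField_inducedCoord he hP _)

lemma mdifferentiableAt_frameV (he : e ∈ IsManifold.maximalAtlas (𝓡 n) ∞ M)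
    (hP : P.proj ∈ e.source) (j : Fin n) :
    MDifferentiableAt (cotModel n) (cotModel n).tangent
      (fun Q : CotangentBundle n M ↦ (⟨Q, frameV e j Q⟩ :
        TangentBundle (cotModel n) (CotangentBundle n M))) P :=
  mdifferentiableAt_constField_inducedCoord he hP _

lemma conn_frameV_frameV_comm (hD' : D'.torsion = 0)
    (he : e ∈ IsManifold.maximalAtlas (𝓡 n) ∞ M) (hP : P.proj ∈ e.source) (i j : Fin n) :
    D' (frameV e j) P (frameV e i P) = D' (frameV e i) P (frameV e j P) :=
  conn_constField_comm hD' he hP _ _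

/-- For a torsion-free connection this is `[E_i, E_j] = p_s R_{ijl}^s E_{n+l}`. -/
lemma conn_frameH_frameH_sub (hD : IsLeviCivita (fun x u v ↦ g.inner x u v) D)
    (hD' : D'.torsion = 0)
    (he : e ∈ IsManifold.maximalAtlas (𝓡 n) ∞ M) (hP : P.proj ∈ e.source) (i j : Fin n) :
    D' (frameH D e j) P (frameH D e i P) - D' (frameH D e i) P (frameH D e j P) =
      ∑ l, (∑ s, pLow e P s * Rm D e P.proj i j l s) • frameV e l P := by
  have : IsManifold (cotModel n) 1 (CotangentBundle n M) := IsManifold.of_le (n := ∞) (by simp)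
  have hm := mdifferentiableAt_constField_inducedCoord he hP
  rw [conn_sub_conn D' (hm _) (hm _) (fun h ↦ hm _)
    (fun h ↦ (hasDirDeriv_horCoeff_frameV hD he hP i i h).1)
    (fun h ↦ (hasDirDeriv_horCoeff_frameV hD he hP j j h).1)
    (conn_constField_comm hD' he hP _ _) (fun h ↦ conn_constField_comm hD' he hP _ _)
    (fun h ↦ conn_constField_comm hD' he hP _ _) (fun h k ↦ conn_constField_comm hD' he hP _ _)
    (frameH_eq i) (frameH_eq j)]
  refine Finset.sum_congr rfl fun l _ ↦ congrArg (· • frameV e l P) ?_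
  rw [(hasDirDeriv_horCoeff_frameH hD he hP i j l).2,
    (hasDirDeriv_horCoeff_frameH hD he hP j i l).2, ← Matrix.sub_apply]
  have h : pRow e P * GamM D e P.proj i * GamM D e P.proj j + pRow e P * dGamM D e P.proj i j
      - (pRow e P * GamM D e P.proj j * GamM D e P.proj i + pRow e P * dGamM D e P.proj j i) =
      pRow e P * RmM D e P.proj i j := by
    rw [Rm_eq hD he hP]
    simp only [Matrix.mul_add, Matrix.mul_sub, Matrix.mul_assoc]
    abel
  rw [h, Matrix.mul_apply]
  rfl

/-- For a torsion-free connection this is `[E_i, E_{n+j}] = -Γ^j_{il} E_{n+l}`. -/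
lemma conn_frameV_frameH_sub (hD : IsLeviCivita (fun x u v ↦ g.inner x u v) D)
    (hD' : D'.torsion = 0)
    (he : e ∈ IsManifold.maximalAtlas (𝓡 n) ∞ M) (hP : P.proj ∈ e.source) (i j : Fin n) :
    D' (frameV e j) P (frameH D e i P) - D' (frameH D e i) P (frameV e j P) =
      ∑ l, (-Gam D e P.proj j i l) • frameV e l P := by
  have : IsManifold (cotModel n) 1 (CotangentBundle n M) := IsManifold.of_le (n := ∞) (by simp)
  have hm := mdifferentiableAt_constField_inducedCoord he hP
  have hY : frameV (M := M) e j = fun Q ↦ natP e j Q + ∑ h, (fun _ ↦ (0 : ℝ)) Q • natP e h Q := by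
    funext Q; simp [frameV]
  rw [conn_sub_conn D' (hm _) (hm _) (fun h ↦ hm _)
    (fun h ↦ (hasDirDeriv_horCoeff_frameV hD he hP i i h).1)
    (fun h ↦ mdifferentiableAt_const)
    (conn_constField_comm hD' he hP _ _) (fun h ↦ conn_constField_comm hD' he hP _ _)
    (fun h ↦ conn_constField_comm hD' he hP _ _) (fun h k ↦ conn_constField_comm hD' he hP _ _)
    (frameH_eq i) hY]
  refine Finset.sum_congr rfl fun l _ ↦ congrArg (· • frameV e l P) ?_
  rw [(hasDirDeriv_horCoeff_frameV hD he hP j i l).2, Gam_symm hD he hP j i l,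
    (HasDirDeriv.const (I := cotModel n) (0 : ℝ)).2, zero_sub]

end FrameTorsion

/-! ### The Levi-Civita connection in the adapted frame -/

section Candidates

variable {n : ℕ} {M : Type*} [TopologicalSpace M] [ChartedSpace (Eucl n) M]
  [IsManifold (𝓡 n) ∞ M] {g : Metric n M} {D : Connection n M} {f : M → ℝ}
  {D' : CotConnection n M} {e : OpenPartialHomeomorph M (Eucl n)} {P : CotangentBundle n M}

/-- The adapted frame `E_1, …, E_{2n}`: the fields `E_j` followed by the fields `E_{n+j}`. -/
def frame (D : Connection n M) (e : OpenPartialHomeomorph M (Eucl n)) :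
    Fin n ⊕ Fin n → ∀ P : CotangentBundle n M, TangentSpace (cotModel n) P
  | .inl i => frameH D e i
  | .inr i => frameV e i

/-- The horizontal components of the covariant derivative of the frame field with the second index
along the frame field with the first. -/
def chrisH (g : Metric n M) (D : Connection n M) (f : M → ℝ)
    (e : OpenPartialHomeomorph M (Eucl n)) (P : CotangentBundle n M) :
    Fin n ⊕ Fin n → Fin n ⊕ Fin n → Fin n → ℝ
  | .inl i, .inl j => fun l ↦ Gam D e P.proj l i j + compA g f e P.proj l i j
  | .inl i, .inr j => fun l ↦
      1 / (2 * f P.proj * alpha g P) * ∑ s, pLow e P s * RmUp g D e P.proj l i j s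
  | .inr i, .inl j => fun l ↦
      1 / (2 * f P.proj * alpha g P) * ∑ s, pLow e P s * RmUp g D e P.proj l j i s
  | .inr _, .inr _ => fun _ ↦ 0

/-- The vertical components of the covariant derivative of the frame field with the second index
along the frame field with the first. -/
def chrisV (g : Metric n M) (D : Connection n M)
    (e : OpenPartialHomeomorph M (Eucl n)) (P : CotangentBundle n M) :
    Fin n ⊕ Fin n → Fin n ⊕ Fin n → Fin n → ℝ
  | .inl i, .inl j => fun l ↦ 1 / 2 * ∑ s, pLow e P s * Rm D e P.proj i j l s
  | .inl i, .inr j => fun l ↦ -Gam D e P.proj j i l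
  | .inr _, .inl _ => fun _ ↦ 0
  | .inr i, .inr j => fun l ↦
      -1 / alpha g P * (pUp g e P i * (1 : Matrix (Fin n) (Fin n) ℝ) j l
          + pUp g e P j * (1 : Matrix (Fin n) (Fin n) ℝ) i l)
        + (alpha g P + 1) / alpha g P ^ 2 * gUp g e P.proj i j * pLow e P l
        + 1 / alpha g P ^ 2 * pUp g e P i * pUp g e P j * pLow e P l

lemma comb_sub (a b a' b' : Fin n → ℝ) :
    comb D e P a b - comb D e P a' b' = comb D e P (a - a') (b - b') := by
  simp only [comb, Pi.sub_apply, sub_smul, Finset.sum_sub_distrib]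
  abel

lemma comb_zero_left (b : Fin n → ℝ) : comb D e P 0 b = ∑ l, b l • frameV e l P := by
  simp [comb]

lemma compA_symm (he : e ∈ IsManifold.maximalAtlas (𝓡 n) ∞ M) {x : M} (hx : x ∈ e.source)
    (l i j : Fin n) : compA g f e x l i j = compA g f e x l j i := by
  rw [compA_eq he hx, compA_eq he hx, gLow_comm g i j]
  ring

lemma Rm_skew (hD : IsLeviCivita (fun x u v ↦ g.inner x u v) D)
    (he : e ∈ IsManifold.maximalAtlas (𝓡 n) ∞ M) {x : M} (hx : x ∈ e.source)
    (i j l s : Fin n) : Rm D e x i j l s = -Rm D e x j i l s :=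
  congrFun (congrFun (RmM_skew hD he hx i j) s) l

/-- The claimed derivatives of frame fields have the same antisymmetrization as those of any
torsion-free connection, namely the bracket of the two frame fields. -/
lemma comb_chris_sub_comb_chris (hD : IsLeviCivita (fun x u v ↦ g.inner x u v) D)
    (hD' : D'.torsion = 0) (he : e ∈ IsManifold.maximalAtlas (𝓡 n) ∞ M) (hP : P.proj ∈ e.source)
    (a b : Fin n ⊕ Fin n) :
    comb D e P (chrisH g D f e P a b) (chrisV g D e P a b)
        - comb D e P (chrisH g D f e P b a) (chrisV g D e P b a) =
      D' (frame D e b) P (frame D e a P) - D' (frame D e a) P (frame D e b P) := by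
  have hHV : ∀ i j,
      comb D e P (chrisH g D f e P (.inl i) (.inr j)) (chrisV g D e P (.inl i) (.inr j))
        - comb D e P (chrisH g D f e P (.inr j) (.inl i)) (chrisV g D e P (.inr j) (.inl i)) =
      D' (frameV e j) P (frameH D e i P) - D' (frameH D e i) P (frameV e j P) := by
    intro i j
    rw [conn_frameV_frameH_sub hD hD' he hP, comb_sub, ← comb_zero_left (D := D)]
    congr 1
    · simp [chrisH]
    · funext l; simp [chrisV]
  rcases a with i | i <;> rcases b with j | j
  · simp only [frame]
    rw [conn_frameH_frameH_sub hD hD' he hP, comb_sub, ← comb_zero_left (D := D)]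
    congr 1
    · funext l
      simp only [chrisH, Pi.sub_apply, Pi.zero_apply, Gam_symm hD he hP l i j,
        compA_symm he hP l i j, sub_self]
    · funext l
      simp only [chrisV, Pi.sub_apply, ← mul_sub, ← Finset.sum_sub_distrib]
      rw [Finset.mul_sum]
      refine Finset.sum_congr rfl fun s _ ↦ ?_
      rw [Rm_skew hD he hP j i]; ring
  · exact hHV i j
  · rw [← neg_sub, hHV j i, neg_sub]; rfl
  · have h : chrisV g D e P (.inr i) (.inr j) = chrisV g D e P (.inr j) (.inr i) := by
      funext l
      simp only [chrisV, gUp_comm g i j]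
      ring
    simp only [frame]
    rw [conn_frameV_frameV_comm hD' he hP, sub_self, h]
    exact sub_self _

/-- `p_s R_{kil}^s p^l = 0`, since curvature endomorphisms are skew-adjoint. -/
lemma sum_Rm_mul_pUp (hD : IsLeviCivita (fun x u v ↦ g.inner x u v) D)
    (he : e ∈ IsManifold.maximalAtlas (𝓡 n) ∞ M) (hP : P.proj ∈ e.source) (k i : Fin n) :
    ∑ l, (∑ s, pLow e P s * Rm D e P.proj k i l s) * pUp g e P l = 0 := by
  set R := RmM D e P.proj k i with hR
  set X : Matrix Unit Unit ℝ := pRow e P * R * (pUpRow g e P).transpose with hX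
  have h1 : gUp g e P.proj * R.transpose + R * gUp g e P.proj = 0 := by
    have h := congrArg (fun A ↦ gUp g e P.proj * A * gUp g e P.proj)
      (RmM_transpose_mul (g := g) hD he hP k i)
    simpa only [Matrix.mul_add, Matrix.add_mul, Matrix.mul_assoc, gLow_mul_gUp g he hP,
      mul_one, ← Matrix.mul_assoc (gUp g e P.proj) (gLow g e P.proj), gUp_mul_gLow g he hP,
      one_mul, mul_zero, zero_mul, Matrix.mul_zero, Matrix.zero_mul, Matrix.mul_one,
      Matrix.one_mul] using h
  -- The scalar `X` equals its transpose, and skew-adjointness of `R` makes the transpose `-X`.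
  have h2 : X.transpose = -X := by
    have h3 : gUp g e P.proj * R.transpose = -(R * gUp g e P.proj) := eq_neg_of_add_eq_zero_left h1
    simp only [hX, pUpRow_eq, Matrix.transpose_mul, Matrix.transpose_transpose, gUp_transpose,
      Matrix.mul_assoc]
    rw [← Matrix.mul_assoc (gUp g e P.proj), h3]
    simp only [Matrix.neg_mul, Matrix.mul_neg, Matrix.mul_assoc]
  have h4 : X () () = 0 := by
    have h5 := congrFun (congrFun h2 ()) ()
    rw [Matrix.transpose_apply, Matrix.neg_apply] at h5
    linarith
  rw [← h4, hX, Matrix.mul_apply]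
  exact Finset.sum_congr rfl fun l _ ↦ by rw [Matrix.mul_apply]; rfl

/-- Lowering the first index of `R^l_k^{js}`. -/
lemma sum_RmUp_mul_gLow (he : e ∈ IsManifold.maximalAtlas (𝓡 n) ∞ M) (hP : P.proj ∈ e.source)
    (i k j : Fin n) :
    ∑ l, (∑ s, pLow e P s * RmUp g D e P.proj l k j s) * gLow g e P.proj l i =
      ∑ m, gUp g e P.proj j m * ∑ s, pLow e P s * Rm D e P.proj i k m s := by
  set W : Fin n → ℝ := fun t ↦ ∑ m, gUp g e P.proj j m * ∑ s, pLow e P s * Rm D e P.proj t k m s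
    with hW
  have h1 : ∀ l, ∑ s, pLow e P s * RmUp g D e P.proj l k j s =
      (gUp g e P.proj).mulVec W l := by
    intro l
    simp only [Matrix.mulVec, dotProduct, hW, RmUp, Finset.mul_sum]
    rw [Finset.sum_comm]
    refine Finset.sum_congr rfl fun t _ ↦ ?_
    rw [Finset.sum_comm]
    exact Finset.sum_congr rfl fun m _ ↦ Finset.sum_congr rfl fun s _ ↦ by ring
  have h2 : (gLow g e P.proj).mulVec ((gUp g e P.proj).mulVec W) = W := by
    rw [Matrix.mulVec_mulVec, gLow_mul_gUp g he hP, Matrix.one_mulVec]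
  simp only [h1]
  refine Eq.trans (Finset.sum_congr rfl fun l _ ↦ ?_) (congrFun h2 i)
  rw [gLow_comm g l i, mul_comm]

/-- Compatibility for the derivative along `E_k` of the vanishing coefficient `G(E_i, E_{n+j})`. The
part of `h` that comes from `p^i p^j` drops out by `sum_Rm_mul_pUp`; the rest cancels by
skew-symmetry of the curvature. -/
lemma comb_chris_metric_HHV (hD : IsLeviCivita (fun x u v ↦ g.inner x u v) D)
    (he : e ∈ IsManifold.maximalAtlas (𝓡 n) ∞ M) (hP : P.proj ∈ e.source) (hf : 0 < f P.proj)
    (k i j : Fin n) :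
    cgMetric g D f P (comb D e P (chrisH g D f e P (.inl k) (.inl i))
        (chrisV g D e P (.inl k) (.inl i))) (frameV e j P)
      + cgMetric g D f P (comb D e P (chrisH g D f e P (.inl k) (.inr j))
        (chrisV g D e P (.inl k) (.inr j))) (frameH D e i P) = 0 := by
  have hα := alpha_pos g P
  rw [cgMetric_comb_frameV hD he hP, cgMetric_comb_frameH hD he hP]
  simp only [chrisH, chrisV, mul_assoc (1 / (2 * f P.proj * alpha g P))]
  rw [← Finset.mul_sum, sum_RmUp_mul_gLow he hP]
  have h1 : ∀ l, 1 / 2 * (∑ s, pLow e P s * Rm D e P.proj k i l s) * hUp g e P l j =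
      (alpha g P)⁻¹ * (1 / 2) * (gUp g e P.proj j l * ∑ s, pLow e P s * Rm D e P.proj k i l s)
      + (alpha g P)⁻¹ * (1 / 2) * pUp g e P j *
        ((∑ s, pLow e P s * Rm D e P.proj k i l s) * pUp g e P l) := by
    intro l
    simp only [hUp, Matrix.of_apply, gUp_comm g l j]
    ring
  simp only [h1]
  rw [Finset.sum_add_distrib, ← Finset.mul_sum, ← Finset.mul_sum, sum_Rm_mul_pUp hD he hP]
  have h2 : ∑ m, gUp g e P.proj j m * ∑ s, pLow e P s * Rm D e P.proj i k m s =
      -∑ m, gUp g e P.proj j m * ∑ s, pLow e P s * Rm D e P.proj k i m s := by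
    rw [← Finset.sum_neg_distrib]
    refine Finset.sum_congr rfl fun m _ ↦ ?_
    rw [← mul_neg, ← Finset.sum_neg_distrib]
    simp only [Rm_skew hD he hP i k, mul_neg]
  rw [h2]
  field_simp
  ring

/-- Compatibility for the derivative of `G(E_i, E_j) = f g_{ij}` along `E_{n+k}`, which vanishes
because `f g_{ij}` is a function on `M`. -/
lemma comb_chris_metric_VHH (hD : IsLeviCivita (fun x u v ↦ g.inner x u v) D)
    (he : e ∈ IsManifold.maximalAtlas (𝓡 n) ∞ M) (hP : P.proj ∈ e.source)
    (k i j : Fin n) :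
    cgMetric g D f P (comb D e P (chrisH g D f e P (.inr k) (.inl i))
        (chrisV g D e P (.inr k) (.inl i))) (frameH D e j P)
      + cgMetric g D f P (comb D e P (chrisH g D f e P (.inr k) (.inl j))
        (chrisV g D e P (.inr k) (.inl j))) (frameH D e i P) = 0 := by
  rw [cgMetric_comb_frameH hD he hP, cgMetric_comb_frameH hD he hP]
  simp only [chrisH, mul_assoc (1 / (2 * f P.proj * alpha g P))]
  rw [← Finset.mul_sum, ← Finset.mul_sum, sum_RmUp_mul_gLow he hP, sum_RmUp_mul_gLow he hP,
    ← mul_add, ← mul_add, ← Finset.sum_add_distrib, Finset.sum_eq_zero fun m _ ↦ ?_, mul_zero,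
    mul_zero]
  rw [← mul_add, ← Finset.sum_add_distrib, Finset.sum_eq_zero fun s _ ↦ ?_, mul_zero]
  rw [Rm_skew hD he hP i j]; ring

lemma sum_chrisV_VV_mul_hUp (he : e ∈ IsManifold.maximalAtlas (𝓡 n) ∞ M) (hP : P.proj ∈ e.source)
    (k i j : Fin n) :
    ∑ l, chrisV g D e P (.inr k) (.inr i) l * hUp g e P l j =
      -1 / alpha g P * (pUp g e P k * hUp g e P i j + pUp g e P i * hUp g e P k j)
        + ((alpha g P + 1) / alpha g P ^ 2 * gUp g e P.proj k i
          + 1 / alpha g P ^ 2 * pUp g e P k * pUp g e P i) * pUp g e P j := by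
  have h1 : ∀ l, chrisV g D e P (.inr k) (.inr i) l * hUp g e P l j =
      -1 / alpha g P * (pUp g e P k * ((1 : Matrix (Fin n) (Fin n) ℝ) i l * hUp g e P l j)
        + pUp g e P i * ((1 : Matrix (Fin n) (Fin n) ℝ) k l * hUp g e P l j))
      + ((alpha g P + 1) / alpha g P ^ 2 * gUp g e P.proj k i
          + 1 / alpha g P ^ 2 * pUp g e P k * pUp g e P i) * (pLow e P l * hUp g e P l j) := by
    intro l; simp only [chrisV]; ring
  simp only [h1]
  rw [Finset.sum_add_distrib, ← Finset.mul_sum, ← Finset.mul_sum, Finset.sum_add_distrib,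
    ← Finset.mul_sum, ← Finset.mul_sum, ← Matrix.mul_apply, ← Matrix.mul_apply, Matrix.one_mul,
    sum_pLow_mul_hUp he hP]

/-- The claimed connection coefficients are compatible with the metric. -/
lemma comb_chris_metric (hD : IsLeviCivita (fun x u v ↦ g.inner x u v) D)
    (he : e ∈ IsManifold.maximalAtlas (𝓡 n) ∞ M) (hP : P.proj ∈ e.source) (hf : 0 < f P.proj)
    (hfd : MDifferentiableAt (𝓡 n) 𝓘(ℝ, ℝ) f P.proj) (a b c : Fin n ⊕ Fin n) :
    mvfderiv (cotModel n) (fun Q ↦ cgMetric g D f Q (frame D e b Q) (frame D e c Q)) P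
        (frame D e a P) =
      cgMetric g D f P (comb D e P (chrisH g D f e P a b) (chrisV g D e P a b)) (frame D e c P)
        + cgMetric g D f P (comb D e P (chrisH g D f e P a c) (chrisV g D e P a c))
          (frame D e b P) := by
  have hα := alpha_pos g P
  have hU := eventually_proj_mem_source hP
  have hHV : ∀ (i j : Fin n) (ξ : TangentSpace (cotModel n) P), mvfderiv (cotModel n)
      (fun Q ↦ cgMetric g D f Q (frameH D e i Q) (frameV e j Q)) P ξ = 0 := fun i j ξ ↦
    ((HasDirDeriv.const (0 : ℝ)).congr'
      (hU.mono fun Q hQ ↦ cgMetric_frameH_frameV hD he hQ i j)).2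
  have hVH : ∀ (i j : Fin n) (ξ : TangentSpace (cotModel n) P), mvfderiv (cotModel n)
      (fun Q ↦ cgMetric g D f Q (frameV e i Q) (frameH D e j Q)) P ξ = 0 := fun i j ξ ↦ by
    simp only [cgMetric_comm (frameV e i _)]
    exact hHV j i ξ
  have hHH : ∀ (i j : Fin n) (ξ : TangentSpace (cotModel n) P) (d : ℝ),
      HasDirDeriv (cotModel n) (fun Q : CotangentBundle n M ↦ f Q.proj * gLow g e Q.proj i j) P ξ d
      → mvfderiv (cotModel n)
        (fun Q ↦ cgMetric g D f Q (frameH D e i Q) (frameH D e j Q)) P ξ = d := fun i j ξ d h ↦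
    (h.congr' (hU.mono fun Q hQ ↦ cgMetric_frameH_frameH hD he hQ i j)).2
  have hVV : ∀ (i j : Fin n) (ξ : TangentSpace (cotModel n) P) (d : ℝ),
      HasDirDeriv (cotModel n) (fun Q : CotangentBundle n M ↦ hUp g e Q i j) P ξ d
      → mvfderiv (cotModel n)
        (fun Q ↦ cgMetric g D f Q (frameV e i Q) (frameV e j Q)) P ξ = d := fun i j ξ d h ↦
    (h.congr' (hU.mono fun Q hQ ↦ cgMetric_frameV_frameV he hQ i j)).2
  rcases a with k | k <;> rcases b with i | i <;> rcases c with j | j <;> simp only [frame]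
  · have h1 : HasDirDeriv (cotModel n) (fun Q : CotangentBundle n M ↦ f Q.proj) P
        (frameH D e k P) (pd f e P.proj k) := by
      refine hasDirDeriv_proj ⟨hfd, ?_⟩
      rw [horPart_frameH he hP]; rfl
    have h2 : HasMatDeriv (cotModel n) (fun Q : CotangentBundle n M ↦ gLow g e Q.proj) P
        (frameH D e k P) ((GamM D e P.proj k).transpose * gLow g e P.proj
          + gLow g e P.proj * GamM D e P.proj k) := by
      refine hasMatDeriv_proj ?_
      rw [horPart_frameH he hP]
      exact hasMatDeriv_gLow hD he hP k
    rw [hHH i j _ _ (h1.mul (h2 i j)), cgMetric_comb_frameH hD he hP,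
      cgMetric_comb_frameH hD he hP, ← sum_compA_mul_gLow he hP f hf.ne' k i j, ← mul_add,
      ← mul_add]
    simp only [chrisH, Matrix.add_apply, Matrix.mul_apply, Matrix.transpose_apply, GamM,
      Matrix.of_apply, add_mul, Finset.sum_add_distrib, gLow_comm g _ i, mul_comm (gLow _ _ _ i _)]
    ring
  · rw [hHV, comb_chris_metric_HHV hD he hP hf]
  · rw [hVH, add_comm, comb_chris_metric_HHV hD he hP hf]
  · rw [hVV i j _ _ (hasMatDeriv_hUp_frameH hD he hP k i j), cgMetric_comb_frameV hD he hP,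
      cgMetric_comb_frameV hD he hP]
    simp only [chrisV, Matrix.neg_apply, Matrix.add_apply, Matrix.mul_apply, GamM, Matrix.of_apply,
      Matrix.transpose_apply, neg_mul, Finset.sum_neg_distrib, neg_add, hUp_comm i]
    simp only [mul_comm (hUp _ _ _ _ i)]
  · rw [comb_chris_metric_VHH hD he hP]
    refine hHH i j _ _ (((hasDirDeriv_proj_frameV he hP hfd k).mul (hasDirDeriv_proj_frameV he hP
      ((contMDiffAt_gLow g he hP i j).mdifferentiableAt (by simp)) k)).congr_val (by simp))
  · rw [hHV, cgMetric_comb_frameV hD he hP, cgMetric_comb_frameH hD he hP]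
    simp [chrisV, chrisH]
  · rw [hVH, cgMetric_comb_frameV hD he hP, cgMetric_comb_frameH hD he hP]
    simp [chrisV, chrisH]
  · rw [hVV i j _ _ (hasDirDeriv_hUp_frameV he hP i j k), cgMetric_comb_frameV hD he hP,
      cgMetric_comb_frameV hD he hP, sum_chrisV_VV_mul_hUp he hP, sum_chrisV_VV_mul_hUp he hP]
    simp only [hUp, Matrix.of_apply, gUp_comm g i k, gUp_comm g j k, gUp_comm g j i]
    field_simp
    ring

/-- The connection in the adapted frame. A tensor `S_{abc}` that is symmetric in `a`, `b` and skew
in `b`, `c` vanishes; this applies to the difference of the two sides, paired with the frame. -/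
lemma conn_frame (hD : IsLeviCivita (fun x u v ↦ g.inner x u v) D)
    (hD' : IsLeviCivita (cgMetric g D f) D')
    (he : e ∈ IsManifold.maximalAtlas (𝓡 n) ∞ M) (hP : P.proj ∈ e.source) (hf : 0 < f P.proj)
    (hfd : MDifferentiableAt (𝓡 n) 𝓘(ℝ, ℝ) f P.proj) (a b : Fin n ⊕ Fin n) :
    D' (frame D e b) P (frame D e a P) =
      comb D e P (chrisH g D f e P a b) (chrisV g D e P a b) := by
  set S : Fin n ⊕ Fin n → Fin n ⊕ Fin n → Fin n ⊕ Fin n → ℝ := fun a b c ↦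
    cgMetric g D f P (D' (frame D e b) P (frame D e a P)
      - comb D e P (chrisH g D f e P a b) (chrisV g D e P a b)) (frame D e c P) with hS
  have hfr : ∀ b, MDifferentiableAt (cotModel n) (cotModel n).tangent
      (fun Q : CotangentBundle n M ↦ (⟨Q, frame D e b Q⟩ :
        TangentBundle (cotModel n) (CotangentBundle n M))) P := by
    rintro (j | j)
    · exact mdifferentiableAt_frameH hD he hP j
    · exact mdifferentiableAt_frameV he hP j
  have hsymm : ∀ a b c, S a b c = S b a c := by
    intro a b c
    have h := comb_chris_sub_comb_chris (f := f) hD hD'.torsion_eq_zero he hP a b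
    have h2 : D' (frame D e b) P (frame D e a P)
        - comb D e P (chrisH g D f e P a b) (chrisV g D e P a b) =
        D' (frame D e a) P (frame D e b P)
        - comb D e P (chrisH g D f e P b a) (chrisV g D e P b a) := by
      rw [sub_eq_sub_iff_sub_eq_sub, ← h]
    simp only [hS, h2]
  have hskew : ∀ a b c, S a b c = -S a c b := by
    intro a b c
    have h1 := hD'.metric_compatible P (frame D e a P) _ _ (hfr b) (hfr c)
    rw [comb_chris_metric hD he hP hf hfd, cgMetric_comm (frame D e b P)] at h1
    simp only [hS, cgMetric_sub_left]
    linarith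
  have hzero : ∀ a b c, S a b c = 0 := by
    intro a b c
    -- Alternating the two symmetries six times returns to `S a b c` with the opposite sign.
    have h1 := hsymm a b c
    have h2 := hskew b a c
    have h3 := hsymm b c a
    have h4 := hskew c b a
    have h5 := hsymm c a b
    have h6 := hskew a c b
    linarith
  exact sub_eq_zero.1 (eq_zero_of_cgMetric_frame hD he hP hf (fun l ↦ hzero a b (.inl l))
    fun l ↦ hzero a b (.inr l))

end Candidates

end CheegerGromoll

end

theorem mainTheorem2 {n : ℕ} {M : Type*} [TopologicalSpace M]
    [ChartedSpace (EuclideanSpace ℝ (Fin n)) M] [IsManifold (𝓡 n) ∞ M]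
    (g : CheegerGromoll.Metric n M) (f : M → ℝ) (hf : ContMDiff (𝓡 n) 𝓘(ℝ, ℝ) ∞ f)
    (hfpos : ∀ x, 0 < f x)
    -- the Levi-Civita connection of `g` on `M`
    (D : CheegerGromoll.Connection n M) (hD : IsLeviCivita (fun x u v ↦ g.inner x u v) D)
    -- the Levi-Civita connection of the rescaled Cheeger-Gromoll type metric on `T*M`
    (D' : CheegerGromoll.CotConnection n M)
    (hD' : IsLeviCivita (CheegerGromoll.cgMetric g D f) D')
    -- a chart of `M` and a point of `T*M` over its domain
    (e : OpenPartialHomeomorph M (EuclideanSpace ℝ (Fin n)))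
    (he : e ∈ IsManifold.maximalAtlas (𝓡 n) ∞ M)
    (P : CheegerGromoll.CotangentBundle n M) (hP : P.proj ∈ e.source) (i j : Fin n) :
    let x : M := P.proj
    let α : ℝ := CheegerGromoll.alpha g P
    let Γ : Fin n → Fin n → Fin n → ℝ := CheegerGromoll.Gam D e x
    let A : Fin n → Fin n → Fin n → ℝ := CheegerGromoll.compA g f e x
    let R : Fin n → Fin n → Fin n → Fin n → ℝ := CheegerGromoll.Rm D e x
    let Rup : Fin n → Fin n → Fin n → Fin n → ℝ := CheegerGromoll.RmUp g D e x
    let gl : Matrix (Fin n) (Fin n) ℝ := CheegerGromoll.gLow g e x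
    let gu : Matrix (Fin n) (Fin n) ℝ := CheegerGromoll.gUp g e x
    let p : Fin n → ℝ := CheegerGromoll.pLow e P
    let pu : Fin n → ℝ := CheegerGromoll.pUp g e P
    let df : Fin n → ℝ := CheegerGromoll.pd f e x
    let δ : Matrix (Fin n) (Fin n) ℝ := 1
    let EH := CheegerGromoll.frameH D e
    let EV := CheegerGromoll.frameV (n := n) (M := M) e
    (∀ l, A l i j
      = 1 / (2 * f x) * (df j * δ l i + df i * δ l j - (∑ m, gu l m * df m) * gl i j)) ∧
    D' (EH j) P (EH i P)
      = ∑ l, (Γ l i j + A l i j) • EH l P + ∑ l, (1 / 2 * ∑ s, p s * R i j l s) • EV l P ∧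
    D' (EV j) P (EH i P)
      = ∑ l, (1 / (2 * f x * α) * ∑ s, p s * Rup l i j s) • EH l P
        + ∑ l, (-Γ j i l) • EV l P ∧
    D' (EH j) P (EV i P)
      = ∑ l, (1 / (2 * f x * α) * ∑ s, p s * Rup l j i s) • EH l P ∧
    D' (EV j) P (EV i P)
      = ∑ l, (-1 / α * (pu i * δ j l + pu j * δ i l) + (α + 1) / α ^ 2 * gu i j * p l
          + 1 / α ^ 2 * pu i * pu j * p l) • EV l P := by
  have hfx := hfpos P.proj
  have hfd : MDifferentiableAt (𝓡 n) 𝓘(ℝ, ℝ) f P.proj := hf.contMDiffAt.mdifferentiableAt (by simp)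
  have h := CheegerGromoll.conn_frame hD hD' he hP hfx hfd
  refine ⟨fun l ↦ CheegerGromoll.compA_eq he hP f l i j, h (.inl i) (.inl j),
    h (.inl i) (.inr j), (h (.inr i) (.inl j)).trans ?_, (h (.inr i) (.inr j)).trans ?_⟩
  · simp [CheegerGromoll.comb, CheegerGromoll.chrisH, CheegerGromoll.chrisV]
  · simp [CheegerGromoll.comb, CheegerGromoll.chrisH, CheegerGromoll.chrisV]
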